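/- Let $n\ge 1$, $p\ge 1$, let $\Omega\subset\mathbf R^{n+1}$ be a bounded domain (nonempty, connected, open) of class $C^2$, $S=\partial\Omega$, $\nu^S$ the inner unit normal along $S$, $h_S$ the second fundamental form of $S$, and let $\rho_S>0$ be the largest $\rho$ such that $(x,t)\mapsto x+t\,\nu^S(x)$ is injective on $S\times[0,\rho)$ (equivalently, a diffeomorphism onto the one-sided tubular neighbourhood of $S$ of width $\rho$). Let $\beta\in C^1(S,(0,\pi))$, and $$G^o_{n,\beta}(S)=\{(x,v)\in S\times\mathbf S^n:\ |\langle v,\nu^S(x)\rangle|=|\cos\beta(x)|\},\qquad \mathbf n^o(x,v)=\frac{\nu^S(x)-\langle v,\nu^S(x)\rangle v}{|\nu^S(x)-\langle v,\nu^S(x)\rangle v|}.$$ An oriented integral $n$-varifold is a Radon measure $V$ on $\mathbf R^{n+1}\times\mathbf S^n$ of the form $$V(\phi)=\int_R\theta_1(x)\phi(x,\xi(x))+\theta_2(x)\phi(x,-\xi(x))\,d\mathcal H^n(x),$$ with $R$ an $n$-rectifiable set, $\xi(x)$ a measurable choice of unit normal to the approximate tangent space of $R$ at $\mathcal H^n$-a.e.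 $x \in R$, and $\theta_1,\theta_2$ locally integrable $\mathbf N$-valued functions on $R$, $(\theta_1,\theta_2)\ne(0,0)$ a.e. For a measure $\mu$ on a product, $\|\mu\|$ denotes its push-forward to the first factor. There is a constant $0<C<\infty$ depending only on $n$, $p$, $\min_S\sin\beta$, $\operatorname{diam}\Omega$, $|h_S|_{C^0(S)}$ and $\rho_S$ with the following property. Let $V$ be an oriented integral $n$-varifold with $\|V\|(\mathbf R^{n+1}\setminus\overline\Omega)=0$ such that $\|V\|$ is $n$-rectifiable of class $C^2$ (that is, $\|V\|=\tau\mathcal H^n\llcorner M$ with $\tau>0$ in $L^1_{\rm loc}(M,\mathcal H^n)$ and $M$ covered, up to an $\mathcal H^n$-null set, by countably many $n$-dimensional $C^2$-submanifolds). Let $\Gamma$ be a Radon measure on $G^o_{n,\beta}(S)$ such that $x\notin\operatorname{spt}\|\Gamma\|$ for $\|V\|$-a.e. $x$. Suppose that $V$ has curvature $W=(W_{ia})_{i,a=1}^{n+1}$ with $W_{ia}\in L^p(V)$ and prescribed contact angle $\beta$ with $S$ along $\Gamma$, that is, for every $\phi\in C^1_c(\mathbf R^{n+1}\times\mathbf R^{n+1})$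 and every $i$ (summing over the repeated indices $j,a,r$) $$\int\Big((\delta_{ij}-v_iv_j)D_{x_j}\phi+W_{ia}D_{v_a}\phi-(W_{rr}v_i+W_{ri}v_r)\phi\Big)dV=-\int\phi\,\mathbf n^o_i\,d\Gamma .$$ Then $$\|V\|(\overline\Omega)\le C\big(\|\Gamma\|(S)+\|W\|_{L^p(V)}^p\big),\qquad \|\Gamma\|(S)\le C\big(\|V\|(\overline\Omega)+\|W\|_{L^p(V)}^p\big),$$ where $\|W\|^p_{L^p(V)}=\int|W|^p\,dV$ and $|W|$ is the Frobenius norm of the matrix $W$. -/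

import Mathlib

open MeasureTheory Set Filter Topology

namespace CapillaryVarifold

noncomputable section

/-- The ambient Euclidean space of dimension `n + 1`. -/
abbrev Amb (n : ℕ) : Type := EuclideanSpace ℝ (Fin (n + 1))

/-- The canonical coordinate vector `e_i`. -/
def coordVec {n : ℕ} (i : Fin (n + 1)) : Amb n := EuclideanSpace.single i (1 : ℝ)

/-! ### Domains of class `C²`, inner normal, second fundamental form, collar -/

/-- `r` is a `C²` defining function of `Ω` near `x` (being `C²` at `x`, it is so in a neighbourhood
of `x`): near `x`, the set `Ω` is `{r > 0}`, and the gradient of `r` does not vanish at `x`. -/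
def IsDefiningAt {n : ℕ} (Ω : Set (Amb n)) (x : Amb n) (r : Amb n → ℝ) : Prop :=
  ContDiffAt ℝ 2 r x ∧ gradient r x ≠ 0 ∧ ∀ᶠ y in 𝓝 x, (y ∈ Ω ↔ 0 < r y)

/-- Bounded domains (nonempty connected open sets) of class `C²`. -/
structure IsBoundedC2Domain {n : ℕ} (Ω : Set (Amb n)) : Prop where
  isOpen : IsOpen Ω
  isConnected : IsConnected Ω
  isBounded : Bornology.IsBounded Ω
  boundary : ∀ x ∈ frontier Ω, ∃ r, IsDefiningAt Ω x r

open Classical in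
/-- A choice of a defining function of `Ω` at `x` (zero if there is none). The inner normal
and the second fundamental form below do not depend on the choice. -/
def definingFun {n : ℕ} (Ω : Set (Amb n)) (x : Amb n) : Amb n → ℝ :=
  if h : ∃ r, IsDefiningAt Ω x r then h.choose else 0

/-- The unit normal `ν^S(x)` of `S = ∂Ω` at `x`, pointing into `Ω`. -/
def innerNormal {n : ℕ} (Ω : Set (Amb n)) (x : Amb n) : Amb n :=
  ‖gradient (definingFun Ω x) x‖⁻¹ • gradient (definingFun Ω x) x

/-- Orthogonal projection of `w` onto the hyperplane `v^⊥`, for a unit vector `v`. -/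
def projPerp {n : ℕ} (v w : Amb n) : Amb n := w - inner ℝ v w • v

/-- The second fundamental form `h_S(u, w) = -⟨D_u ν^S, w⟩` of `S = ∂Ω` at `x`, for `u, w` tangent to
`S` at `x`. -/
def secondFF {n : ℕ} (Ω : Set (Amb n)) (x u w : Amb n) : ℝ :=
  -(fderiv ℝ (fderiv ℝ (definingFun Ω x)) x u w) / ‖gradient (definingFun Ω x) x‖

/-- The (Hilbert-Schmidt) norm `|h_S(x)|` of the second fundamental form. -/
def secondFFNorm {n : ℕ} (Ω : Set (Amb n)) (x : Amb n) : ℝ :=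
  Real.sqrt (∑ i, ∑ j, secondFF Ω x (projPerp (innerNormal Ω x) (coordVec i))
    (projPerp (innerNormal Ω x) (coordVec j)) ^ 2)

/-- `|h_S|_{C⁰(S)}`, the maximum over `S = ∂Ω` of the norm of the second fundamental form. -/
def secondFFSup {n : ℕ} (Ω : Set (Amb n)) : ℝ := ⨆ x : frontier Ω, secondFFNorm Ω x

/-- The collar width `ρ_S`: the largest `ρ` such that the inward normal exponential map
`(x, t) ↦ x + t ν^S(x)` is injective on `S × [0, ρ)` (for a bounded `C²` domain this is the
same as being a diffeomorphism onto the one-sided tubular neighbourhood of width `ρ`). -/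
def collarWidth {n : ℕ} (Ω : Set (Amb n)) : ℝ :=
  sSup {ρ : ℝ | 0 ≤ ρ ∧
    InjOn (fun q : Amb n × ℝ => q.1 + q.2 • innerNormal Ω q.1) (frontier Ω ×ˢ Ico 0 ρ)}

/-! ### Angle functions and the oriented capillary bundle -/

/-- `β ∈ C¹(S, (0, π))`, `S = ∂Ω`; only the values of `β` on `S` matter. -/
structure IsAngle {n : ℕ} (Ω : Set (Amb n)) (β : Amb n → ℝ) : Prop where
  contDiffOn : ContDiffOn ℝ 1 β (frontier Ω)
  mem_Ioo : ∀ x ∈ frontier Ω, β x ∈ Ioo 0 Real.pi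

/-- `min_S sin β`. -/
def minSin {n : ℕ} (Ω : Set (Amb n)) (β : Amb n → ℝ) : ℝ :=
  ⨅ x : frontier Ω, Real.sin (β x)

/-- The oriented capillary bundle `G^o_{n,β}(S)`, `S = ∂Ω`. -/
def capBundle {n : ℕ} (Ω : Set (Amb n)) (β : Amb n → ℝ) : Set (Amb n × Amb n) :=
  {z | z.1 ∈ frontier Ω ∧ ‖z.2‖ = 1 ∧ |inner ℝ z.2 (innerNormal Ω z.1)| = |Real.cos (β z.1)|}

/-- The unit co-normal `n^o(x, v) = v^⊥(ν^S(x)) / |v^⊥(ν^S(x))|`. -/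
def conormal {n : ℕ} (Ω : Set (Amb n)) (z : Amb n × Amb n) : Amb n :=
  ‖projPerp z.2 (innerNormal Ω z.1)‖⁻¹ • projPerp z.2 (innerNormal Ω z.1)

/-- `Γ` is a Radon measure on `G^o_{n,β}(S)`. -/
structure IsCapillaryMeasure {n : ℕ} (Ω : Set (Amb n)) (β : Amb n → ℝ)
    (Γ : Measure (Amb n × Amb n)) : Prop where
  isLocallyFinite : IsLocallyFiniteMeasure Γ
  concentrated : Γ (capBundle Ω β)ᶜ = 0

/-! ### Rectifiability -/

/-- `M` is an (embedded, `n`-dimensional) hypersurface of class `C^k`, without boundary. -/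
def IsHypersurface {n : ℕ} (k : ℕ) (M : Set (Amb n)) : Prop :=
  ∀ x ∈ M, ∃ f : Amb n → ℝ, ContDiffAt ℝ k f x ∧ gradient f x ≠ 0 ∧
    ∀ᶠ y in 𝓝 x, (y ∈ M ↔ f y = 0)

/-- `R` is `n`-rectifiable of class `C^k`: up to an `H^n`-null set, it is covered by countably
many hypersurfaces of class `C^k`. For `k = 1` this is `n`-rectifiability. -/
def IsRectifiableSet {n : ℕ} (k : ℕ) (R : Set (Amb n)) : Prop :=
  ∃ M : ℕ → Set (Amb n), (∀ m, IsHypersurface k (M m)) ∧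
    (μHE[n] : Measure (Amb n)) (R \ ⋃ m, M m) = 0

/-- `μ` is `n`-rectifiable of class `C^k`: `μ = τ H^n ⌞ M`, where `M` is `n`-rectifiable of class
`C^k` and `τ > 0` is in `L¹_loc(M, H^n)`. -/
def IsRectifiableMeasure {n : ℕ} (k : ℕ) (μ : Measure (Amb n)) : Prop :=
  ∃ (M : Set (Amb n)) (τ : Amb n → ℝ), MeasurableSet M ∧ IsRectifiableSet k M ∧
    Measurable τ ∧ (∀ x ∈ M, 0 < τ x) ∧ LocallyIntegrable τ ((μHE[n]).restrict M) ∧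
    μ = ((μHE[n]).restrict M).withDensity (fun x => ENNReal.ofReal (τ x))

/-- `v` is a unit normal to the approximate tangent space of `R` at `x`: the rescalings
`(R - x) / r` converge to the hyperplane `v^⊥`, as `r → 0⁺`, weakly as measures. -/
def IsApproxUnitNormal {n : ℕ} (R : Set (Amb n)) (x v : Amb n) : Prop :=
  ‖v‖ = 1 ∧ ∀ φ : Amb n → ℝ, Continuous φ → HasCompactSupport φ →
    Tendsto (fun r : ℝ => (r ^ n)⁻¹ * ∫ y in R, φ (r⁻¹ • (y - x)) ∂(μHE[n])) (𝓝[>] 0)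
      (𝓝 (∫ y in {y : Amb n | inner ℝ v y = 0}, φ y ∂(μHE[n])))

/-! ### Oriented integral varifolds -/

/-- The weight measure `‖V‖ = π_# V`, `π(x, v) = x`. -/
def weight {n : ℕ} (V : Measure (Amb n × Amb n)) : Measure (Amb n) := V.map Prod.fst

/-- Oriented `n`-varifolds: Radon measures on the product of the ambient space with the
unit sphere. -/
structure IsOrientedVarifold {n : ℕ} (V : Measure (Amb n × Amb n)) : Prop where
  isLocallyFinite : IsLocallyFiniteMeasure V
  unit : V {z | ‖z.2‖ ≠ 1} = 0

/-- Oriented integral `n`-varifolds `V = v(R, ξ, θ₁, θ₂)`. -/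
structure IsOrientedIntegralVarifold {n : ℕ} (V : Measure (Amb n × Amb n)) : Prop
    extends IsOrientedVarifold V where
  representation : ∃ (R : Set (Amb n)) (ξ : Amb n → Amb n) (θ₁ θ₂ : Amb n → ℕ),
    MeasurableSet R ∧ IsRectifiableSet 1 R ∧
    Measurable ξ ∧ Measurable θ₁ ∧ Measurable θ₂ ∧
    LocallyIntegrable (fun x => (θ₁ x : ℝ)) ((μHE[n]).restrict R) ∧
    LocallyIntegrable (fun x => (θ₂ x : ℝ)) ((μHE[n]).restrict R) ∧
    (∀ᵐ x ∂((μHE[n]).restrict R), IsApproxUnitNormal R x (ξ x)) ∧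
    (∀ᵐ x ∂((μHE[n]).restrict R), (θ₁ x, θ₂ x) ≠ (0, 0)) ∧
    V = (((μHE[n]).restrict R).withDensity (fun x => (θ₁ x : ENNReal))).map (fun x => (x, ξ x))
      + (((μHE[n]).restrict R).withDensity (fun x => (θ₂ x : ENNReal))).map (fun x => (x, -ξ x))

/-! ### Curvature and prescribed contact angle -/

/-- The integrand of the weak first variation identity, for the coefficients `W`, the test
function `φ` and the index `i`, at the point `z = (x, v)`:
`(δ_ij - v_i v_j) D_j φ + W_ia D*_a φ - (W_rr v_i + W_ri v_r) φ`, summed over `j, a, r`. -/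
def variationIntegrand {n : ℕ} (W : Fin (n + 1) → Fin (n + 1) → Amb n × Amb n → ℝ)
    (φ : Amb n × Amb n → ℝ) (i : Fin (n + 1)) (z : Amb n × Amb n) : ℝ :=
  (∑ j, ((if i = j then 1 else 0) - z.2 i * z.2 j) * fderiv ℝ φ z (coordVec j, 0))
    + (∑ a, W i a z * fderiv ℝ φ z (0, coordVec a))
    - (∑ r, (W r r z * z.2 i + W r i z * z.2 r)) * φ z

/-- `V` has curvature, with coefficients `W_ia`, and prescribed contact angle with `S = ∂Ω` along
`Γ`. (The angle `β` enters through the bundle on which `Γ` lives.) -/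
structure HasCurvatureAlong {n : ℕ} (Ω : Set (Amb n)) (V Γ : Measure (Amb n × Amb n))
    (W : Fin (n + 1) → Fin (n + 1) → Amb n × Amb n → ℝ) : Prop where
  aemeasurable : ∀ i a, AEMeasurable (W i a) V
  integrable : ∀ φ : Amb n × Amb n → ℝ, ContDiff ℝ 1 φ → HasCompactSupport φ →
    ∀ i, Integrable (variationIntegrand W φ i) V
  identity : ∀ φ : Amb n × Amb n → ℝ, ContDiff ℝ 1 φ → HasCompactSupport φ →
    ∀ i, ∫ z, variationIntegrand W φ i z ∂V = -∫ z, φ z * conormal Ω z i ∂Γ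

/-- The Frobenius norm of the matrix `W(x, v) = (W_ia(x, v))`. -/
def frobNorm {n : ℕ} (W : Fin (n + 1) → Fin (n + 1) → Amb n × Amb n → ℝ)
    (z : Amb n × Amb n) : ℝ :=
  Real.sqrt (∑ i, ∑ a, W i a z ^ 2)

/-- `‖W‖_{L^p(V)}^p`, the integral of the `p`-th power of the Frobenius norm of `W`. -/
def curvatureEnergy {n : ℕ} (p : ℝ) (V : Measure (Amb n × Amb n))
    (W : Fin (n + 1) → Fin (n + 1) → Amb n × Amb n → ℝ) : ENNReal :=
  ∫⁻ z, ENNReal.ofReal (frobNorm W z ^ p) ∂V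

end

end CapillaryVarifold

open CapillaryVarifold

/-! Both inequalities come from one identity. Testing with `φ(x, v) = X_i(x)` and summing over `i`
kills the derivatives in `v` and leaves `∫ (div_{v^⊥} X - (curvature term, linear in W and X)) dV =
-∫ ⟨X, n^o⟩ dΓ` (`HasCurvatureAlong.identity_vectorField`).

For the mass bound take `X(x) = x - x₀` with `x₀ ∈ Ω`. Its divergence along a hyperplane is `n ≥ 1`
and its length is at most the diameter, so the mass is bounded by `Γ` and `∫ |W|`. The inequality `a
≤ ε + ε^(1-p) a^p` turns `|W|` into `|W|^p` plus a small multiple of the mass, which is absorbed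
(`mass_le_boundary_add_energy`).

For the boundary bound take `X` equal to the inner normal on `S`. On the capillary bundle `⟨ν^S,
n^o⟩ = sin β`, so the right side dominates `min sin β` times the mass of `Γ`
(`boundary_le_mass_add_energy`).

The geometric work lies in extending `ν^S` to a `C¹` field with derivative controlled only by
`|h_S|` and `ρ_S` (`exists_normal_extension`). The field is a cutoff of the distance times `ν^S` at
the nearest point of `S`. Within the collar width the nearest point is unique, hence continuous in
the point. The inverse function theorem for `(x, t) ↦ x + t ν^S(x)` then makes it `C¹` wherever `t
|h_S| < 1`. Differentiating `y = foot y + d(y) ν^S(foot y)` bounds its derivative by 2 where `d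
|h_S| ≤ 1/2`.

Since the normal and the second fundamental form are built from a defining function chosen
separately at each point, their independence of that choice is needed before any regularity along
`S` can be stated. -/

namespace CapillaryVarifold

/-! ### Vectors and half-spaces -/

/-- If the open half-space `{⟪a, ·⟫ > 0}` is contained in `{⟪b, ·⟫ ≥ 0}`, then `a` and `b` point in
the same direction. -/
theorem norm_smul_eq_of_halfSpace_subset {F : Type*} [NormedAddCommGroup F]
    [InnerProductSpace ℝ F] {a b : F} (h : ∀ w : F, 0 < inner ℝ a w → 0 ≤ inner ℝ b w) :
    ‖b‖ • a = ‖a‖ • b := by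
  rw [← inner_eq_norm_mul_iff_real]
  by_contra hne
  have hlt : inner ℝ a b < ‖a‖ * ‖b‖ := lt_of_le_of_ne (real_inner_le_norm a b) hne
  have ha : 0 < ‖a‖ := by
    rcases (norm_nonneg a).eq_or_lt with h0 | h0
    · rw [eq_comm, norm_eq_zero] at h0; simp [h0] at hlt
    · exact h0
  have hb : 0 < ‖b‖ := by
    rcases (norm_nonneg b).eq_or_lt with h0 | h0
    · rw [eq_comm, norm_eq_zero] at h0; simp [h0] at hlt
    · exact h0
  -- If Cauchy-Schwarz were strict, this vector would have positive product with `a` and negative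
  -- product with `b`.
  have key := h (‖b‖ • a - ‖a‖ • b) (by
    rw [inner_sub_right, inner_smul_right, inner_smul_right, real_inner_self_eq_norm_sq]
    nlinarith [mul_pos ha (sub_pos.2 hlt)])
  rw [inner_sub_right, inner_smul_right, inner_smul_right, real_inner_self_eq_norm_sq,
    real_inner_comm] at key
  nlinarith [mul_pos hb (sub_pos.2 hlt)]

theorem inv_norm_smul_eq {F : Type*} [NormedAddCommGroup F] [InnerProductSpace ℝ F] {a b : F}
    (ha : a ≠ 0) (hb : b ≠ 0) (h : ‖b‖ • a = ‖a‖ • b) : ‖a‖⁻¹ • a = ‖b‖⁻¹ • b := by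
  have ha' := norm_ne_zero_iff.2 ha
  have hb' := norm_ne_zero_iff.2 hb
  rw [inv_smul_eq_iff₀ ha', smul_smul, mul_comm, ← smul_smul, ← h, inv_smul_smul₀ hb']

theorem norm_inv_norm_smul {F : Type*} [NormedAddCommGroup F] [InnerProductSpace ℝ F] {a : F}
    (ha : a ≠ 0) : ‖‖a‖⁻¹ • a‖ = 1 := by
  rw [norm_smul, norm_inv, norm_norm, inv_mul_cancel₀ (norm_ne_zero_iff.2 ha)]

/-! ### Taylor expansion along lines and parabolas -/

section Taylor

variable {F : Type*} [NormedAddCommGroup F] [NormedSpace ℝ F] {r : F → ℝ} {x : F}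

theorem eventually_pos_of_fderiv_pos (hr : DifferentiableAt ℝ r x) (h0 : r x = 0) {w : F}
    (hw : 0 < fderiv ℝ r x w) : ∀ᶠ s : ℝ in 𝓝[>] 0, 0 < r (x + s • w) := by
  have hγ : HasDerivAt (fun s : ℝ => x + s • w) w 0 := by
    simpa using ((hasDerivAt_id (0 : ℝ)).smul_const w).const_add x
  have hd : HasDerivAt (fun s : ℝ => r (x + s • w)) (fderiv ℝ r x w) 0 := by
    have : HasFDerivAt r (fderiv ℝ r x) (x + (0 : ℝ) • w) := by simpa using hr.hasFDerivAt
    exact this.comp_hasDerivAt 0 hγ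
  have := eventually_nhdsWithin_sign_eq_of_deriv_pos (f := fun s : ℝ => r (x + s • w))
    (x₀ := 0) (by rw [hd.deriv]; exact hw) (by simpa using h0)
  filter_upwards [this.filter_mono nhdsWithin_le_nhds, self_mem_nhdsWithin] with s hs hs0
  rw [sub_zero, sign_pos (mem_Ioi.1 hs0), sign_eq_one_iff] at hs
  exact hs

theorem eventually_pos_along_parabola (hr : ContDiffAt ℝ 2 r x) (h0 : r x = 0) {u b : F}
    (hu : fderiv ℝ r x u = 0)
    (h : 0 < fderiv ℝ (fderiv ℝ r) x u u + 2 * fderiv ℝ r x b) :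
    ∀ᶠ s : ℝ in 𝓝[>] 0, 0 < r (x + s • u + s ^ 2 • b) := by
  -- The second derivative of `r ∘ γ` at 0 is `4ε`. Subtracting `ε s²` leaves `2ε > 0`, so the
  -- second derivative test gives `r (γ s) ≥ ε s²` near 0.
  set ε : ℝ := (fderiv ℝ (fderiv ℝ r) x u u + 2 * fderiv ℝ r x b) / 4 with hε
  have hεpos : 0 < ε := by positivity
  set γ : ℝ → F := fun s => x + s • u + s ^ 2 • b with hγ
  have hγ0 : γ 0 = x := by simp [hγ]
  have hγd : ∀ s, HasDerivAt γ (u + (2 * s) • b) s := fun s => by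
    have h1 : HasDerivAt (fun s : ℝ => x + s • u) u s := by
      simpa using ((hasDerivAt_id s).smul_const u).const_add x
    have h2 : HasDerivAt (fun s : ℝ => s ^ 2 • b) ((2 * s) • b) s := by
      simpa using ((hasDerivAt_pow 2 s).smul_const b)
    exact h1.add h2
  have hγc : ContinuousAt γ 0 := (hγd 0).continuousAt
  set f : ℝ → ℝ := fun s => r (γ s) - ε * s ^ 2 with hf
  have hrd : ∀ᶠ y in 𝓝 x, DifferentiableAt ℝ r y := by
    filter_upwards [hr.eventually (by simp)] with y hy using hy.differentiableAt (by simp)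
  have hfd : ∀ᶠ s in 𝓝 (0 : ℝ),
      HasDerivAt f (fderiv ℝ r (γ s) (u + (2 * s) • b) - ε * (2 * s)) s := by
    have := hγc.eventually (by rw [hγ0]; exact hrd)
    filter_upwards [this] with s hs
    have h2 : HasDerivAt (fun s : ℝ => ε * s ^ 2) (ε * (2 * s)) s := by
      simpa using (hasDerivAt_pow 2 s).const_mul ε
    exact (hs.hasFDerivAt.comp_hasDerivAt s (hγd s)).sub h2
  have hfd' : deriv f =ᶠ[𝓝 0] fun s => fderiv ℝ r (γ s) (u + (2 * s) • b) - ε * (2 * s) := by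
    filter_upwards [hfd] with s hs using hs.deriv
  have hD : HasFDerivAt (fderiv ℝ r) (fderiv ℝ (fderiv ℝ r) x) (γ 0) := by
    rw [hγ0]
    exact ((hr.fderiv_right (m := 1) (by norm_num)).differentiableAt (by simp)).hasFDerivAt
  have hdd : HasDerivAt (fun s => fderiv ℝ r (γ s) (u + (2 * s) • b) - ε * (2 * s))
      (fderiv ℝ (fderiv ℝ r) x u u + 2 * fderiv ℝ r x b - ε * 2) 0 := by
    have h1 : HasDerivAt (fun s => fderiv ℝ r (γ s)) (fderiv ℝ (fderiv ℝ r) x u) 0 := by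
      have := hD.comp_hasDerivAt 0 (hγd 0)
      rw [mul_zero, zero_smul, add_zero] at this
      exact this
    have h2 : HasDerivAt (fun s : ℝ => u + (2 * s) • b) ((2 : ℝ) • b) 0 := by
      simpa using (((hasDerivAt_id (0 : ℝ)).const_mul 2).smul_const b).const_add u
    have h3 : HasDerivAt (fun s : ℝ => ε * (2 * s)) (ε * 2) 0 := by
      simpa using ((hasDerivAt_id (0 : ℝ)).const_mul 2).const_mul ε
    have h4 := (h1.clm_apply h2).fun_sub h3
    rw [mul_zero, zero_smul, add_zero, hγ0, map_smul, smul_eq_mul] at h4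
    exact h4
  have hmin : IsLocalMin f 0 := by
    refine isLocalMin_of_deriv_deriv_pos ?_ ?_ hfd.self_of_nhds.continuousAt
    · rw [hfd'.deriv_eq, hdd.deriv, hε]; linarith
    · rw [hfd'.self_of_nhds]; simp [hγ0, hu]
  filter_upwards [hmin.filter_mono nhdsWithin_le_nhds, self_mem_nhdsWithin] with s hs hs0
  have hf0 : f 0 = 0 := by simp [hf, hγ0, h0]
  rw [hf0] at hs
  have : 0 < ε * s ^ 2 := mul_pos hεpos (pow_pos hs0 2)
  simp only [hf, hγ] at hs
  linarith

end Taylor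

/-! ### Defining functions -/

section Defining

variable {n : ℕ} {Ω : Set (Amb n)} {x : Amb n} {r r₁ r₂ : Amb n → ℝ}

theorem contDiffAt_gradient {f : Amb n → ℝ} (hf : ContDiffAt ℝ 2 f x) :
    ContDiffAt ℝ 1 (gradient f) x := by
  have := hf.fderiv_right (m := 1) (by norm_num)
  exact (InnerProductSpace.toDual ℝ (Amb n)).symm.toContinuousLinearEquiv.contDiff.contDiffAt.comp
    x this

theorem IsDefiningAt.eventually (h : IsDefiningAt Ω x r) : ∀ᶠ y in 𝓝 x, IsDefiningAt Ω y r := by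
  obtain ⟨h1, h2, h3⟩ := h
  filter_upwards [h1.eventually (by simp),
    (contDiffAt_gradient h1).continuousAt.eventually_ne h2, h3.eventually_nhds] with y a b c
  exact ⟨a, b, c⟩

theorem IsDefiningAt.eq_zero (hΩ : IsOpen Ω) (h : IsDefiningAt Ω x r) (hx : x ∈ frontier Ω) :
    r x = 0 := by
  apply le_antisymm
  · by_contra! hlt
    have := (h.2.2.self_of_nhds).2 hlt
    rw [hΩ.frontier_eq] at hx
    exact hx.2 this
  · have hc : ContinuousAt r x := h.1.continuousAt
    by_contra! hlt
    have h1 : ∀ᶠ y in 𝓝 x, y ∉ Ω := by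
      filter_upwards [hc.eventually_lt continuousAt_const hlt, h.2.2] with y hy hy'
      rw [hy']; exact not_lt.2 hy.le
    have h2 : ∃ᶠ y in 𝓝 x, y ∈ Ω := mem_closure_iff_frequently.1 (frontier_subset_closure hx)
    exact h2 h1

theorem IsDefiningAt.differentiableAt (h : IsDefiningAt Ω x r) : DifferentiableAt ℝ r x :=
  h.1.differentiableAt (by simp)

theorem IsDefiningAt.eventually_mem (hΩ : IsOpen Ω) (h : IsDefiningAt Ω x r)
    (hx : x ∈ frontier Ω) {w : Amb n} (hw : 0 < inner ℝ (gradient r x) w) :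
    ∀ᶠ s : ℝ in 𝓝[>] 0, x + s • w ∈ Ω := by
  rw [inner_gradient_left] at hw
  have hc : Tendsto (fun s : ℝ => x + s • w) (𝓝[>] 0) (𝓝 x) := by
    have : ContinuousAt (fun s : ℝ => x + s • w) 0 := by fun_prop
    have h2 := this.tendsto.mono_left (nhdsWithin_le_nhds (s := Ioi 0))
    simpa using h2
  filter_upwards [eventually_pos_of_fderiv_pos h.differentiableAt (h.eq_zero hΩ hx) hw,
    hc.eventually h.2.2] with s h1 h2 using h2.2 h1

theorem IsDefiningAt.nonneg_of_eventually_mem (hΩ : IsOpen Ω) (h : IsDefiningAt Ω x r)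
    (hx : x ∈ frontier Ω) {w : Amb n} (hw : ∀ᶠ s : ℝ in 𝓝[>] 0, x + s • w ∈ Ω) :
    0 ≤ inner ℝ (gradient r x) w := by
  rw [inner_gradient_left]
  by_contra! hlt
  have hd : fderiv ℝ (fun y => -r y) x w = -fderiv ℝ r x w := by
    rw [fderiv_fun_neg]; rfl
  have hneg := eventually_pos_of_fderiv_pos (r := fun y => -r y) h.differentiableAt.neg
    (by simp [h.eq_zero hΩ hx]) (w := w) (by rw [hd]; linarith)
  have hc : Tendsto (fun s : ℝ => x + s • w) (𝓝[>] 0) (𝓝 x) := by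
    have : ContinuousAt (fun s : ℝ => x + s • w) 0 := by fun_prop
    have h2 := this.tendsto.mono_left (nhdsWithin_le_nhds (s := Ioi 0))
    simpa using h2
  obtain ⟨s, h1, h2, h3⟩ := (hneg.and (hw.and (hc.eventually h.2.2))).exists
  have := h3.1 h2
  linarith

/-- Two defining functions have the same normalized gradient. -/
theorem IsDefiningAt.normalized_gradient_eq (hΩ : IsOpen Ω) (h₁ : IsDefiningAt Ω x r₁)
    (h₂ : IsDefiningAt Ω x r₂) (hx : x ∈ frontier Ω) :
    ‖gradient r₁ x‖⁻¹ • gradient r₁ x = ‖gradient r₂ x‖⁻¹ • gradient r₂ x :=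
  inv_norm_smul_eq h₁.2.1 h₂.2.1 (norm_smul_eq_of_halfSpace_subset fun _ hw =>
    h₂.nonneg_of_eventually_mem hΩ hx (h₁.eventually_mem hΩ hx hw))

theorem IsDefiningAt.fderiv_eq_zero_of_inner (h₁ : IsDefiningAt Ω x r)
    {u : Amb n} (hu : inner ℝ (‖gradient r x‖⁻¹ • gradient r x) u = 0) :
    fderiv ℝ r x u = 0 := by
  rw [inner_smul_left, inner_gradient_left] at hu
  have := norm_ne_zero_iff.2 h₁.2.1
  simpa [this] using hu

theorem IsDefiningAt.fderiv_unit (h₁ : IsDefiningAt Ω x r) :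
    fderiv ℝ r x (‖gradient r x‖⁻¹ • gradient r x) = ‖gradient r x‖ := by
  rw [← inner_gradient_left, inner_smul_right, real_inner_self_eq_norm_sq]
  have := norm_ne_zero_iff.2 h₁.2.1
  field_simp

/-- A value `a` strictly between the two quotients would give a parabola `x + s u - (a/2) s² ν`
along which `r₁ > 0` and `r₂ < 0` for small `s > 0`. Its points would lie both inside and outside
`Ω`. -/
theorem IsDefiningAt.hessian_div_le (hΩ : IsOpen Ω) (h₁ : IsDefiningAt Ω x r₁)
    (h₂ : IsDefiningAt Ω x r₂) (hx : x ∈ frontier Ω) {u : Amb n}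
    (hu : inner ℝ (‖gradient r₁ x‖⁻¹ • gradient r₁ x) u = 0) :
    fderiv ℝ (fderiv ℝ r₁) x u u / ‖gradient r₁ x‖
      ≤ fderiv ℝ (fderiv ℝ r₂) x u u / ‖gradient r₂ x‖ := by
  by_contra! hlt
  set ν := ‖gradient r₁ x‖⁻¹ • gradient r₁ x with hν
  have hν2 : ν = ‖gradient r₂ x‖⁻¹ • gradient r₂ x := h₁.normalized_gradient_eq hΩ h₂ hx
  have m1 := norm_pos_iff.2 h₁.2.1
  have m2 := norm_pos_iff.2 h₂.2.1
  obtain ⟨a, ha2, ha1⟩ := exists_between hlt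
  rw [div_lt_iff₀ m2] at ha2
  rw [lt_div_iff₀ m1] at ha1
  have e1 : fderiv ℝ r₁ x ν = ‖gradient r₁ x‖ := h₁.fderiv_unit
  have e2 : fderiv ℝ r₂ x ν = ‖gradient r₂ x‖ := by rw [hν2]; exact h₂.fderiv_unit
  have p1 := eventually_pos_along_parabola h₁.1 (h₁.eq_zero hΩ hx) (u := u) (b := (-a / 2) • ν)
    (h₁.fderiv_eq_zero_of_inner hu) (by rw [map_smul, e1, smul_eq_mul]; linarith)
  have hd : fderiv ℝ (fun y => -r₂ y) = fun y => -fderiv ℝ r₂ y := by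
    ext1 y; rw [fderiv_fun_neg]
  have p2 := eventually_pos_along_parabola (r := fun y => -r₂ y) h₂.1.neg
    (by simp [h₂.eq_zero hΩ hx]) (u := u) (b := (-a / 2) • ν)
    (by rw [hd]; simp [h₂.fderiv_eq_zero_of_inner (hν2 ▸ hu)])
    (by rw [hd, fderiv_fun_neg, neg_apply, neg_apply,
          neg_apply, map_smul, e2, smul_eq_mul]; linarith)
  have hc : Tendsto (fun s : ℝ => x + s • u + s ^ 2 • ((-a / 2) • ν)) (𝓝[>] 0) (𝓝 x) := by
    have : ContinuousAt (fun s : ℝ => x + s • u + s ^ 2 • ((-a / 2) • ν)) 0 := by fun_prop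
    have h2 := this.tendsto.mono_left (nhdsWithin_le_nhds (s := Ioi 0))
    simpa using h2
  obtain ⟨s, q1, q2, q3, q4⟩ :=
    (p1.and (p2.and ((hc.eventually h₁.2.2).and (hc.eventually h₂.2.2)))).exists
  have := q4.1 (q3.2 q1)
  linarith

/-- Two defining functions have the same normalized Hessian on tangent vectors. -/
theorem IsDefiningAt.hessian_div_eq (hΩ : IsOpen Ω) (h₁ : IsDefiningAt Ω x r₁)
    (h₂ : IsDefiningAt Ω x r₂) (hx : x ∈ frontier Ω) {u w : Amb n}
    (hu : inner ℝ (‖gradient r₁ x‖⁻¹ • gradient r₁ x) u = 0)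
    (hw : inner ℝ (‖gradient r₁ x‖⁻¹ • gradient r₁ x) w = 0) :
    fderiv ℝ (fderiv ℝ r₁) x u w / ‖gradient r₁ x‖
      = fderiv ℝ (fderiv ℝ r₂) x u w / ‖gradient r₂ x‖ := by
  have hν2 := h₁.normalized_gradient_eq hΩ h₂ hx
  have quad : ∀ z, inner ℝ (‖gradient r₁ x‖⁻¹ • gradient r₁ x) z = 0 →
      fderiv ℝ (fderiv ℝ r₁) x z z / ‖gradient r₁ x‖
      = fderiv ℝ (fderiv ℝ r₂) x z z / ‖gradient r₂ x‖ := fun z hz =>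
    le_antisymm (h₁.hessian_div_le hΩ h₂ hx hz) (h₂.hessian_div_le hΩ h₁ hx (hν2 ▸ hz))
  have s1 : fderiv ℝ (fderiv ℝ r₁) x u w = fderiv ℝ (fderiv ℝ r₁) x w u :=
    h₁.1.isSymmSndFDerivAt (by simp) u w
  have s2 : fderiv ℝ (fderiv ℝ r₂) x u w = fderiv ℝ (fderiv ℝ r₂) x w u :=
    h₂.1.isSymmSndFDerivAt (by simp) u w
  -- Polarization: both Hessians are symmetric, so agreement on the diagonal suffices.
  have q := quad (u + w) (by rw [inner_add_right, hu, hw, add_zero])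
  have qu := quad u hu
  have qw := quad w hw
  simp only [map_add, add_apply, add_div] at q
  rw [← s1, ← s2] at q
  linarith

theorem definingFun_spec (hΩ : IsBoundedC2Domain Ω) (hx : x ∈ frontier Ω) :
    IsDefiningAt Ω x (definingFun Ω x) := by
  have h := hΩ.boundary x hx
  rw [definingFun, dif_pos h]
  exact h.choose_spec

theorem innerNormal_eq (hΩ : IsBoundedC2Domain Ω) (hx : x ∈ frontier Ω)
    (h : IsDefiningAt Ω x r) : innerNormal Ω x = ‖gradient r x‖⁻¹ • gradient r x :=
  (definingFun_spec hΩ hx).normalized_gradient_eq hΩ.isOpen h hx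

theorem norm_innerNormal (hΩ : IsBoundedC2Domain Ω) (hx : x ∈ frontier Ω) :
    ‖innerNormal Ω x‖ = 1 :=
  norm_inv_norm_smul (definingFun_spec hΩ hx).2.1

theorem secondFF_eq (hΩ : IsBoundedC2Domain Ω) (hx : x ∈ frontier Ω)
    (h : IsDefiningAt Ω x r) {u w : Amb n} (hu : inner ℝ (innerNormal Ω x) u = 0)
    (hw : inner ℝ (innerNormal Ω x) w = 0) :
    secondFF Ω x u w = -(fderiv ℝ (fderiv ℝ r) x u w) / ‖gradient r x‖ := by
  rw [secondFF, neg_div, neg_div,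
    (definingFun_spec hΩ hx).hessian_div_eq hΩ.isOpen h hx hu hw]

end Defining

/-! ### The normalized gradient and the second fundamental form -/

section NormalField

variable {n : ℕ} {Ω : Set (Amb n)} {x : Amb n} {r : Amb n → ℝ}

/-- The normalized gradient of `r`. -/
noncomputable def unitGrad (r : Amb n → ℝ) (y : Amb n) : Amb n :=
  ‖gradient r y‖⁻¹ • gradient r y

theorem IsDefiningAt.contDiffAt_unitGrad (h : IsDefiningAt Ω x r) :
    ContDiffAt ℝ 1 (unitGrad r) x :=
  (((contDiffAt_gradient h.1).norm ℝ h.2.1).inv (norm_ne_zero_iff.2 h.2.1)).smul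
    (contDiffAt_gradient h.1)

theorem IsDefiningAt.norm_unitGrad (h : IsDefiningAt Ω x r) : ‖unitGrad r x‖ = 1 :=
  norm_inv_norm_smul h.2.1

theorem IsDefiningAt.eventually_innerNormal_eq (hΩ : IsBoundedC2Domain Ω)
    (h : IsDefiningAt Ω x r) :
    ∀ᶠ y in 𝓝 x, y ∈ frontier Ω → innerNormal Ω y = unitGrad r y := by
  filter_upwards [h.eventually] with y hy hyS using innerNormal_eq hΩ hyS hy

theorem IsDefiningAt.inner_fderiv_unitGrad_self (h : IsDefiningAt Ω x r) (u : Amb n) :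
    inner ℝ (unitGrad r x) (fderiv ℝ (unitGrad r) x u) = 0 := by
  have hd : DifferentiableAt ℝ (unitGrad r) x := h.contDiffAt_unitGrad.differentiableAt (by simp)
  have hc : (fun y => inner ℝ (unitGrad r y) (unitGrad r y)) =ᶠ[𝓝 x] fun _ => (1 : ℝ) := by
    filter_upwards [h.eventually] with y hy
    rw [real_inner_self_eq_norm_sq, hy.norm_unitGrad, one_pow]
  have h1 := fderiv_inner_apply ℝ hd hd u
  rw [hc.fderiv_eq, fderiv_const_apply, real_inner_comm] at h1
  have h2 : (0 : ℝ) = 2 * inner ℝ (unitGrad r x) (fderiv ℝ (unitGrad r) x u) := by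
    rw [two_mul]; nth_rewrite 1 [real_inner_comm]; simpa [real_inner_comm] using h1
  linarith

theorem inner_fderiv_gradient (h : ContDiffAt ℝ 2 r x) (u w : Amb n) :
    inner ℝ (fderiv ℝ (gradient r) x u) w = fderiv ℝ (fderiv ℝ r) x u w := by
  have h1 : DifferentiableAt ℝ (gradient r) x :=
    (contDiffAt_gradient h).differentiableAt (by simp)
  have h2 : DifferentiableAt ℝ (fderiv ℝ r) x :=
    (h.fderiv_right (m := 1) (by norm_num)).differentiableAt (by simp)
  have e : (fun y => inner ℝ (gradient r y) w) = fun y => fderiv ℝ r y w := by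
    ext1 y; rw [inner_gradient_left]
  have h3 := fderiv_inner_apply ℝ h1 (differentiableAt_const w) u
  rw [e, fderiv_clm_apply h2 (differentiableAt_const w)] at h3
  simpa using h3.symm

theorem IsDefiningAt.inner_fderiv_unitGrad (h : IsDefiningAt Ω x r) (u : Amb n) {w : Amb n}
    (hw : inner ℝ (unitGrad r x) w = 0) :
    inner ℝ (fderiv ℝ (unitGrad r) x u) w = fderiv ℝ (fderiv ℝ r) x u w / ‖gradient r x‖ := by
  have hd : DifferentiableAt ℝ (unitGrad r) x := h.contDiffAt_unitGrad.differentiableAt (by simp)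
  have hn : DifferentiableAt ℝ (fun y => ‖gradient r y‖) x :=
    ((contDiffAt_gradient h.1).norm ℝ h.2.1).differentiableAt (by simp)
  -- Product rule for `∇r = |∇r| ν`: the term that differentiates `|∇r|` is a multiple of `ν`, hence
  -- orthogonal to `w`.
  have e : gradient r =ᶠ[𝓝 x] fun y => ‖gradient r y‖ • unitGrad r y := by
    filter_upwards [h.eventually] with y hy
    rw [unitGrad, smul_inv_smul₀ (norm_ne_zero_iff.2 hy.2.1)]
  rw [eq_div_iff (norm_ne_zero_iff.2 h.2.1), ← inner_fderiv_gradient h.1, e.fderiv_eq,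
    fderiv_fun_smul hn hd]
  simp only [add_apply, smul_apply, ContinuousLinearMap.smulRight_apply, inner_add_left,
    inner_smul_left, hw]
  simp [mul_comm]

theorem innerNormal_continuousOn (hΩ : IsBoundedC2Domain Ω) :
    ContinuousOn (innerNormal Ω) (frontier Ω) := by
  intro y hy
  have h := definingFun_spec hΩ hy
  refine (h.contDiffAt_unitGrad.continuousAt.continuousWithinAt).congr_of_eventuallyEq ?_
    (innerNormal_eq hΩ hy h)
  filter_upwards [nhdsWithin_le_nhds (h.eventually_innerNormal_eq hΩ), self_mem_nhdsWithin]
    with z hz hzS using hz hzS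

theorem isCompact_frontier (hΩ : IsBoundedC2Domain Ω) : IsCompact (frontier Ω) :=
  Metric.isCompact_of_isClosed_isBounded isClosed_frontier
    (hΩ.isBounded.closure.subset frontier_subset_closure)

theorem frontier_nonempty (hΩ : IsBoundedC2Domain Ω) : (frontier Ω).Nonempty := by
  rw [nonempty_frontier_iff]
  refine ⟨hΩ.isConnected.nonempty, fun h => ?_⟩
  exact NormedSpace.unbounded_univ ℝ (Amb n) (h ▸ hΩ.isBounded)

theorem inner_projPerp {v : Amb n} (hv : ‖v‖ = 1) (w : Amb n) : inner ℝ v (projPerp v w) = 0 := by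
  rw [projPerp, inner_sub_right, inner_smul_right, real_inner_self_eq_norm_sq, hv]
  ring

theorem secondFFNorm_continuousOn (hΩ : IsBoundedC2Domain Ω) :
    ContinuousOn (secondFFNorm Ω) (frontier Ω) := by
  intro y hy
  have h := definingFun_spec hΩ hy
  set r := definingFun Ω y with hr
  have e : ∀ z ∈ frontier Ω, IsDefiningAt Ω z r → secondFFNorm Ω z =
      Real.sqrt (∑ i, ∑ j, (-(fderiv ℝ (fderiv ℝ r) z (projPerp (unitGrad r z) (coordVec i))
        (projPerp (unitGrad r z) (coordVec j))) / ‖gradient r z‖) ^ 2) := by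
    intro z hz hzr
    have hν := norm_innerNormal hΩ hz
    have : unitGrad r z = innerNormal Ω z := (innerNormal_eq hΩ hz hzr).symm
    rw [secondFFNorm, this]
    congr 1
    refine Finset.sum_congr rfl fun i _ => Finset.sum_congr rfl fun j _ => ?_
    rw [secondFF_eq hΩ hz hzr (inner_projPerp hν _) (inner_projPerp hν _)]
  have hc : ContinuousAt (fun z => Real.sqrt (∑ i, ∑ j,
      (-(fderiv ℝ (fderiv ℝ r) z (projPerp (unitGrad r z) (coordVec i))
        (projPerp (unitGrad r z) (coordVec j))) / ‖gradient r z‖) ^ 2)) y := by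
    have c1 : ContinuousAt (unitGrad r) y := h.contDiffAt_unitGrad.continuousAt
    have c2 : ContinuousAt (gradient r) y := (contDiffAt_gradient h.1).continuousAt
    have c3 : ContinuousAt (fderiv ℝ (fderiv ℝ r)) y :=
      ((h.1.fderiv_right (m := 1) (by norm_num)).fderiv_right (m := 0) (by simp)).continuousAt
    have c4 : ∀ i, ContinuousAt (fun z => projPerp (unitGrad r z) (coordVec i)) y := fun i => by
      unfold projPerp; fun_prop
    refine Real.continuous_sqrt.continuousAt.comp ?_
    refine tendsto_finsetSum _ fun i _ => tendsto_finsetSum _ fun j _ => ?_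
    exact ((((c3.clm_apply (c4 i)).clm_apply (c4 j)).neg).div c2.norm
      (norm_ne_zero_iff.2 h.2.1)).pow 2
  refine hc.continuousWithinAt.congr_of_eventuallyEq ?_ (e y hy h)
  filter_upwards [nhdsWithin_le_nhds h.eventually, self_mem_nhdsWithin] with z hz hzS
    using e z hzS hz

theorem secondFFNorm_le_sup (hΩ : IsBoundedC2Domain Ω) (hx : x ∈ frontier Ω) :
    secondFFNorm Ω x ≤ secondFFSup Ω := by
  refine le_ciSup (f := fun x : frontier Ω => secondFFNorm Ω x) ?_ ⟨x, hx⟩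
  have := (isCompact_frontier hΩ).bddAbove_image (secondFFNorm_continuousOn hΩ)
  rwa [image_eq_range] at this

theorem secondFFSup_nonneg : 0 ≤ secondFFSup Ω :=
  Real.iSup_nonneg fun _ => Real.sqrt_nonneg _

theorem eq_sum_coordVec (u : Amb n) : u = ∑ i, u i • coordVec i := by
  have := (EuclideanSpace.basisFun (Fin (n + 1)) ℝ).sum_repr u
  simpa [coordVec] using this.symm

/-- A tangent vector expands in the projected coordinate vectors with its own coordinates. The
Hilbert-Schmidt norm over this overcomplete family therefore bounds the bilinear form by a single
Cauchy-Schwarz. -/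
theorem projPerp_eq_sum (v : Amb n) {u : Amb n} (hu : inner ℝ v u = 0) :
    u = ∑ i, u i • projPerp v (coordVec i) := by
  have h1 : ∑ i, u i • projPerp v (coordVec i) = projPerp v u := by
    simp only [projPerp, smul_sub, Finset.sum_sub_distrib, ← eq_sum_coordVec u, smul_smul,
      ← Finset.sum_smul, ← inner_smul_right, ← inner_sum]
  rw [h1, projPerp, hu, zero_smul, sub_zero]

theorem abs_secondFF_le (Ω : Set (Amb n)) (x : Amb n) {u w : Amb n}
    (hu : inner ℝ (innerNormal Ω x) u = 0) (hw : inner ℝ (innerNormal Ω x) w = 0) :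
    |secondFF Ω x u w| ≤ secondFFNorm Ω x * (‖u‖ * ‖w‖) := by
  set e := fun i : Fin (n + 1) => projPerp (innerNormal Ω x) (coordVec i) with he
  set B := fun p : Fin (n + 1) × Fin (n + 1) => secondFF Ω x (e p.1) (e p.2) with hB
  have h1 : secondFF Ω x u w = ∑ p : Fin (n + 1) × Fin (n + 1), B p * (u p.1 * w p.2) := by
    conv_lhs => rw [projPerp_eq_sum _ hu, projPerp_eq_sum _ hw]
    rw [Fintype.sum_prod_type]
    simp only [secondFF, hB, he, map_sum, sum_apply, map_smul, smul_apply, smul_eq_mul]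
    rw [← Finset.sum_neg_distrib, Finset.sum_div]
    simp only [Finset.mul_sum, ← Finset.sum_neg_distrib, Finset.sum_div]
    rw [Finset.sum_comm]
    refine Finset.sum_congr rfl fun i _ => Finset.sum_congr rfl fun j _ => ?_
    ring
  have hn : ∀ z : Amb n, ‖z‖ ^ 2 = ∑ i, z i ^ 2 := fun z => by
    simp [EuclideanSpace.norm_sq_eq]
  have h2 : (secondFF Ω x u w) ^ 2 ≤ (secondFFNorm Ω x * (‖u‖ * ‖w‖)) ^ 2 := by
    rw [h1]
    refine (Finset.sum_mul_sq_le_sq_mul_sq _ _ _).trans (le_of_eq ?_)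
    have h3 : ‖u‖ ^ 2 * ‖w‖ ^ 2 = ∑ p : Fin (n + 1) × Fin (n + 1), (u p.1 * w p.2) ^ 2 := by
      rw [hn, hn, Finset.sum_mul_sum, Fintype.sum_prod_type]
      simp only [mul_pow]
    rw [mul_pow, mul_pow, h3, secondFFNorm, Real.sq_sqrt (by positivity),
      Fintype.sum_prod_type (f := fun p => B p ^ 2)]
  have h3 : 0 ≤ secondFFNorm Ω x * (‖u‖ * ‖w‖) :=
    mul_nonneg (Real.sqrt_nonneg _) (by positivity)
  exact abs_le_of_sq_le_sq h2 h3

/-- The derivative of the unit normal is bounded by the second fundamental form. -/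
theorem norm_fderiv_unitGrad_le (hΩ : IsBoundedC2Domain Ω) (hx : x ∈ frontier Ω)
    (h : IsDefiningAt Ω x r) {u : Amb n} (hu : inner ℝ (unitGrad r x) u = 0) :
    ‖fderiv ℝ (unitGrad r) x u‖ ≤ secondFFSup Ω * ‖u‖ := by
  set w := fderiv ℝ (unitGrad r) x u with hw
  have hν : innerNormal Ω x = unitGrad r x := innerNormal_eq hΩ hx h
  have hwν : inner ℝ (unitGrad r x) w = 0 := h.inner_fderiv_unitGrad_self u
  -- `w = Dν(u)` is itself tangent, so `‖w‖² = -h_S(u, w)`, and one factor `‖w‖` cancels.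
  have h1 : ‖w‖ * ‖w‖ ≤ (secondFFSup Ω * ‖u‖) * ‖w‖ := by
    rw [← real_inner_self_eq_norm_mul_norm]
    conv_lhs => rw [hw]
    rw [h.inner_fderiv_unitGrad u hwν]
    have h2 := secondFF_eq hΩ hx h (hν ▸ hu) (hν ▸ hwν)
    have h3 := abs_secondFF_le Ω x (hν ▸ hu) (hν ▸ hwν)
    rw [h2, neg_div, abs_neg] at h3
    refine (le_abs_self _).trans (h3.trans ?_)
    rw [mul_assoc]
    exact mul_le_mul_of_nonneg_right (secondFFNorm_le_sup hΩ hx) (by positivity)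
  rcases (norm_nonneg w).eq_or_lt with h0 | h0
  · rw [← h0]; exact mul_nonneg secondFFSup_nonneg (norm_nonneg _)
  · exact le_of_mul_le_mul_right h1 h0

end NormalField

/-! ### Nearest points on the boundary -/

section Foot

variable {n : ℕ} {Ω : Set (Amb n)} {x y : Amb n} {r : Amb n → ℝ}

theorem subset_of_isPreconnected {X : Type*} [TopologicalSpace X] {Ω s : Set X} (hΩ : IsOpen Ω)
    (hs : IsPreconnected s) (hd : Disjoint s (frontier Ω)) (hne : (s ∩ Ω).Nonempty) : s ⊆ Ω := by
  refine hs.subset_left_of_subset_union hΩ (isClosed_closure (s := Ω)).isOpen_compl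
    (disjoint_compl_right.mono_left subset_closure) (fun z hz => ?_) hne
  by_cases h : z ∈ Ω
  · exact Or.inl h
  · refine Or.inr fun hc => hd.le_bot ⟨hz, ?_⟩
    rw [hΩ.frontier_eq]
    exact ⟨hc, h⟩

theorem disjoint_ball_of_nearest (hnear : ∀ z ∈ frontier Ω, dist y x ≤ dist y z) :
    Disjoint (Metric.ball y (dist y x)) (frontier Ω) := by
  rw [disjoint_left]
  intro z hz hzS
  have := hnear z hzS
  rw [Metric.mem_ball, dist_comm] at hz
  linarith

theorem eventually_mem_ball_of_inner_pos {w : Amb n} (hw : 0 < inner ℝ (y - x) w) :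
    ∀ᶠ s : ℝ in 𝓝[>] 0, x + s • w ∈ Metric.ball y (dist y x) := by
  have hc : ContinuousAt (fun s : ℝ => s * ‖w‖ ^ 2) 0 := by fun_prop
  have h1 : ∀ᶠ s : ℝ in 𝓝 0, s * ‖w‖ ^ 2 < 2 * inner ℝ (y - x) w :=
    hc.eventually_lt continuousAt_const (by simpa using hw)
  filter_upwards [h1.filter_mono nhdsWithin_le_nhds, self_mem_nhdsWithin] with s hs hs0
  rw [Metric.mem_ball, dist_comm, dist_eq_norm, dist_eq_norm]
  have hs0' : 0 < s := hs0
  refine lt_of_pow_lt_pow_left₀ 2 (norm_nonneg _) ?_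
  have e : y - (x + s • w) = (y - x) - s • w := by abel
  rw [e, norm_sub_sq_real, norm_smul, inner_smul_right, mul_pow, Real.norm_eq_abs, sq_abs]
  nlinarith

/-- The ball about `y` through `x` misses `S`, hence lies in `Ω` and touches `S` at `x`. The
directions entering the ball then enter `Ω`, which forces `y - x` to be a positive multiple of the
gradient. -/
theorem eq_add_of_nearest_of_mem (hΩ : IsBoundedC2Domain Ω) (hy : y ∈ Ω) (hx : x ∈ frontier Ω)
    (hnear : ∀ z ∈ frontier Ω, dist y x ≤ dist y z) : y = x + dist y x • innerNormal Ω x := by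
  have h := definingFun_spec hΩ hx
  have hyx : 0 < dist y x := by
    refine dist_pos.2 fun e => ?_
    rw [hΩ.isOpen.frontier_eq] at hx
    exact hx.2 (e ▸ hy)
  have hball : Metric.ball y (dist y x) ⊆ Ω :=
    subset_of_isPreconnected hΩ.isOpen (convex_ball _ _).isPreconnected
      (disjoint_ball_of_nearest hnear) ⟨y, Metric.mem_ball_self hyx, hy⟩
  have hne : y - x ≠ 0 := by rwa [dist_eq_norm, norm_pos_iff] at hyx
  have key := inv_norm_smul_eq hne h.2.1
    (norm_smul_eq_of_halfSpace_subset fun w hw => h.nonneg_of_eventually_mem hΩ.isOpen hx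
      ((eventually_mem_ball_of_inner_pos hw).mono fun s hs => hball hs))
  rw [innerNormal, ← key, dist_eq_norm, smul_inv_smul₀ (norm_ne_zero_iff.2 hne)]
  abel

theorem eq_sub_of_nearest_of_notMem (hΩ : IsBoundedC2Domain Ω) (hy : y ∉ Ω) (hx : x ∈ frontier Ω)
    (hnear : ∀ z ∈ frontier Ω, dist y x ≤ dist y z) : y = x - dist y x • innerNormal Ω x := by
  have h := definingFun_spec hΩ hx
  rcases eq_or_ne y x with rfl | hyx
  · simp
  have hyx := dist_pos.2 hyx
  have hball : ∀ z ∈ Metric.ball y (dist y x), z ∉ Ω := fun z hz hzΩ =>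
    hy (subset_of_isPreconnected hΩ.isOpen (convex_ball _ _).isPreconnected
      (disjoint_ball_of_nearest hnear) ⟨z, hz, hzΩ⟩ (Metric.mem_ball_self hyx))
  have hne : y - x ≠ 0 := by rwa [dist_eq_norm, norm_pos_iff] at hyx
  have key := inv_norm_smul_eq hne (neg_ne_zero.2 h.2.1)
    (norm_smul_eq_of_halfSpace_subset fun w hw => by
      rw [inner_neg_left, Left.nonneg_neg_iff]
      by_contra! hlt
      obtain ⟨s, h1, h2⟩ := ((eventually_mem_ball_of_inner_pos hw).and
        (h.eventually_mem hΩ.isOpen hx hlt)).exists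
      exact hball _ h1 h2)
  rw [norm_neg, smul_neg] at key
  rw [innerNormal, ← neg_eq_iff_eq_neg.2 key, dist_eq_norm, smul_neg,
    smul_inv_smul₀ (norm_ne_zero_iff.2 hne)]
  abel

open Classical in
/-- The signed distance to the boundary, positive inside. -/
noncomputable def signedDist (Ω : Set (Amb n)) (y : Amb n) : ℝ :=
  if y ∈ Ω then Metric.infDist y (frontier Ω) else -Metric.infDist y (frontier Ω)

open Classical in
/-- A nearest point of the boundary. -/
noncomputable def foot (Ω : Set (Amb n)) (y : Amb n) : Amb n :=
  if h : ∃ x ∈ frontier Ω, Metric.infDist y (frontier Ω) = dist y x then h.choose else y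

theorem foot_spec (hΩ : IsBoundedC2Domain Ω) (y : Amb n) :
    foot Ω y ∈ frontier Ω ∧ Metric.infDist y (frontier Ω) = dist y (foot Ω y) := by
  have h : ∃ x ∈ frontier Ω, Metric.infDist y (frontier Ω) = dist y x :=
    (isCompact_frontier hΩ).exists_infDist_eq_dist (frontier_nonempty hΩ) y
  rw [foot, dif_pos h]
  exact h.choose_spec

theorem dist_foot_le (hΩ : IsBoundedC2Domain Ω) (y : Amb n) {z : Amb n} (hz : z ∈ frontier Ω) :
    dist y (foot Ω y) ≤ dist y z :=
  (foot_spec hΩ y).2 ▸ Metric.infDist_le_dist_of_mem hz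

theorem abs_signedDist (Ω : Set (Amb n)) (y : Amb n) :
    |signedDist Ω y| = Metric.infDist y (frontier Ω) := by
  rw [signedDist]
  split_ifs
  · exact abs_of_nonneg Metric.infDist_nonneg
  · rw [abs_neg]; exact abs_of_nonneg Metric.infDist_nonneg

theorem signedDist_eq_infDist (hΩ : IsBoundedC2Domain Ω) (hy : y ∈ closure Ω) :
    signedDist Ω y = Metric.infDist y (frontier Ω) := by
  rw [signedDist]
  split_ifs with h
  · rfl
  · have : y ∈ frontier Ω := by rw [hΩ.isOpen.frontier_eq]; exact ⟨hy, h⟩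
    rw [Metric.infDist_zero_of_mem this, neg_zero]

/-- Thanks to the sign this holds on both sides of `S`, so it can be differentiated at boundary
points as well. -/
theorem foot_add_signedDist (hΩ : IsBoundedC2Domain Ω) (y : Amb n) :
    foot Ω y + signedDist Ω y • innerNormal Ω (foot Ω y) = y := by
  rw [signedDist, (foot_spec hΩ y).2]
  split_ifs with h
  · exact (eq_add_of_nearest_of_mem hΩ h (foot_spec hΩ y).1 fun z hz => dist_foot_le hΩ y hz).symm
  · rw [neg_smul, ← sub_eq_add_neg]
    exact (eq_sub_of_nearest_of_notMem hΩ h (foot_spec hΩ y).1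
      fun z hz => dist_foot_le hΩ y hz).symm

theorem continuousAt_signedDist (hΩ : IsBoundedC2Domain Ω) (hy : y ∈ closure Ω) :
    ContinuousAt (signedDist Ω) y := by
  by_cases h : y ∈ Ω
  · refine (Metric.continuous_infDist_pt (frontier Ω)).continuousAt.congr ?_
    filter_upwards [hΩ.isOpen.mem_nhds h] with z hz
    rw [signedDist, if_pos hz]
  · have hyS : y ∈ frontier Ω := by rw [hΩ.isOpen.frontier_eq]; exact ⟨hy, h⟩
    have h0 : signedDist Ω y = 0 := by
      rw [signedDist_eq_infDist hΩ hy, Metric.infDist_zero_of_mem hyS]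
    rw [ContinuousAt, h0, tendsto_zero_iff_norm_tendsto_zero]
    simp only [Real.norm_eq_abs, abs_signedDist]
    have := (Metric.continuous_infDist_pt (frontier Ω)).tendsto y
    rwa [Metric.infDist_zero_of_mem hyS] at this

end Foot

/-! ### The normal exponential map -/

section NormalExp

variable {n : ℕ} {Ω : Set (Amb n)} {x y : Amb n} {r : Amb n → ℝ}

/-- To avoid charts of `S`, the exponential map is completed to a map of `ℝ^(n+1) × ℝ` into itself
by recording `r` as a second component; `S` is then the slice where that component vanishes. -/
theorem exists_local_inverse (hΩ : IsBoundedC2Domain Ω) (hx : x ∈ frontier Ω) {t : ℝ}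
    (ht : |t| * secondFFSup Ω < 1) :
    ∃ H : Amb n → Amb n × ℝ, ContDiffAt ℝ 1 H (x + t • innerNormal Ω x) ∧
      ∀ᶠ p in 𝓝 (x, t), p.1 ∈ frontier Ω → H (p.1 + p.2 • innerNormal Ω p.1) = p := by
  have h := definingFun_spec hΩ hx
  set r := definingFun Ω x with hr
  set ν := unitGrad r with hν
  have hνx : innerNormal Ω x = ν x := rfl
  set G : Amb n × ℝ → Amb n × ℝ := fun p => (p.1 + p.2 • ν p.1, r p.1) with hG
  have hνc : ContDiffAt ℝ 1 ν x := h.contDiffAt_unitGrad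
  have hνd : HasFDerivAt ν (fderiv ℝ ν x) x := (hνc.differentiableAt (by simp)).hasFDerivAt
  have hGc : ContDiffAt ℝ 1 G (x, t) := by
    have c1 : ContDiffAt ℝ 1 (fun p : Amb n × ℝ => ν p.1) (x, t) :=
      ContDiffAt.comp (g := ν) (f := Prod.fst) (x, t) hνc contDiffAt_fst
    have c2 : ContDiffAt ℝ 1 (fun p : Amb n × ℝ => r p.1) (x, t) :=
      ContDiffAt.comp (g := r) (f := Prod.fst) (x, t) (h.1.of_le (by norm_num)) contDiffAt_fst
    exact (contDiffAt_fst.add (contDiffAt_snd.smul c1)).prodMk c2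
  set fst := ContinuousLinearMap.fst ℝ (Amb n) ℝ with hfst
  set snd := ContinuousLinearMap.snd ℝ (Amb n) ℝ with hsnd
  set G' : Amb n × ℝ →L[ℝ] Amb n × ℝ :=
    (fst + (t • (fderiv ℝ ν x ∘L fst) + snd.smulRight (ν x))).prod (fderiv ℝ r x ∘L fst) with hG'
  have hGd : HasFDerivAt G G' (x, t) := by
    have c1 : HasFDerivAt (fun p : Amb n × ℝ => ν p.1) (fderiv ℝ ν x ∘L fst) (x, t) :=
      HasFDerivAt.comp (g := ν) (f := Prod.fst) (x, t) hνd hasFDerivAt_fst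
    have c2 : HasFDerivAt (fun p : Amb n × ℝ => r p.1) (fderiv ℝ r x ∘L fst) (x, t) :=
      HasFDerivAt.comp (g := r) (f := Prod.fst) (x, t) h.differentiableAt.hasFDerivAt
        hasFDerivAt_fst
    exact (hasFDerivAt_fst.add (hasFDerivAt_snd.smul c1)).prodMk c2
  -- For `(u, s)` in the kernel, `Dr u = 0` makes `u` tangent and the normal component gives `s =
  -- 0`. Then `u = -t Dν(u)` has norm at most `|t| K ‖u‖` with `|t| K < 1`. In finite dimension
  -- injectivity suffices.
  have hinj : Function.Injective G' := by
    rw [injective_iff_map_eq_zero]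
    rintro ⟨u, s⟩ hus
    simp only [hG', hfst, hsnd, ContinuousLinearMap.prod_apply, Prod.mk_eq_zero] at hus
    obtain ⟨e1, e2⟩ := hus
    replace e1 : u + (t • fderiv ℝ ν x u + s • ν x) = 0 := e1
    replace e2 : fderiv ℝ r x u = 0 := e2
    have hu : inner ℝ (ν x) u = 0 := by
      rw [hν, unitGrad, inner_smul_left, inner_gradient_left, e2, mul_zero]
    have hs : s = 0 := by
      have := congrArg (fun z => inner ℝ (ν x) z) e1
      have h1 : ‖ν x‖ = 1 := h.norm_unitGrad
      have h2 : inner ℝ (ν x) (fderiv ℝ ν x u) = 0 := h.inner_fderiv_unitGrad_self u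
      simpa [inner_add_right, inner_smul_right, hu, h1, h2] using this
    rw [hs, zero_smul, add_zero] at e1
    have hb : ‖fderiv ℝ ν x u‖ ≤ secondFFSup Ω * ‖u‖ := norm_fderiv_unitGrad_le hΩ hx h hu
    have hle : ‖u‖ ≤ (|t| * secondFFSup Ω) * ‖u‖ := by
      conv_lhs => rw [eq_neg_of_add_eq_zero_left e1, norm_neg, norm_smul, Real.norm_eq_abs]
      rw [mul_assoc]
      exact mul_le_mul_of_nonneg_left hb (abs_nonneg t)
    have hu0 : u = 0 := by
      rw [← norm_eq_zero]
      nlinarith [norm_nonneg u]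
    rw [hu0, hs]; rfl
  set e : (Amb n × ℝ) ≃L[ℝ] (Amb n × ℝ) :=
    (LinearEquiv.ofInjectiveEndo G'.toLinearMap hinj).toContinuousLinearEquiv with he
  have hee : (e : Amb n × ℝ →L[ℝ] Amb n × ℝ) = G' :=
    ContinuousLinearMap.coeFn_injective rfl
  rw [← hee] at hGd
  set L := hGc.localInverse hGd (by simp) with hL
  have hGx : G (x, t) = (x + t • innerNormal Ω x, 0) := by
    simp only [hG, h.eq_zero hΩ.isOpen hx, hνx]
  refine ⟨fun z => L (z, 0), ?_, ?_⟩
  · have c := hGc.to_localInverse hGd (by simp)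
    rw [hGx] at c
    exact c.comp (x + t • innerNormal Ω x) (contDiffAt_id.prodMk contDiffAt_const)
  · have ev := (hGc.hasStrictFDerivAt' hGd (by simp)).eventually_left_inverse
    have ev2 : ∀ᶠ p : Amb n × ℝ in 𝓝 (x, t), IsDefiningAt Ω p.1 r :=
      (continuous_fst.tendsto (x, t)).eventually h.eventually
    filter_upwards [ev, ev2] with p hp hp2 hpS
    have : G p = (p.1 + p.2 • innerNormal Ω p.1, 0) := by
      rw [innerNormal_eq hΩ hpS hp2]
      simp only [hG, hp2.eq_zero hΩ.isOpen hpS, hν, unitGrad]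
    rw [← this]
    exact hp

theorem eventually_eq_of_normalExp_eq (hΩ : IsBoundedC2Domain Ω) (hx : x ∈ frontier Ω) :
    ∃ U ∈ 𝓝 (x, (0 : ℝ)), InjOn (fun q : Amb n × ℝ => q.1 + q.2 • innerNormal Ω q.1)
      (U ∩ frontier Ω ×ˢ univ) := by
  obtain ⟨H, -, h⟩ := exists_local_inverse hΩ hx (t := 0) (by simp)
  refine ⟨_, h, fun p hp q hq hpq => ?_⟩
  have hp' := hp.1 hp.2.1
  have hq' := hq.1 hq.2.1
  simp only at hpq
  rw [← hp', ← hq', hpq]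

/-- The radii of injectivity whose supremum is `collarWidth`. -/
def collarRadii (Ω : Set (Amb n)) : Set ℝ :=
  {ρ : ℝ | 0 ≤ ρ ∧
    InjOn (fun q : Amb n × ℝ => q.1 + q.2 • innerNormal Ω q.1) (frontier Ω ×ˢ Ico 0 ρ)}

theorem injOn_collarWidth (Ω : Set (Amb n)) :
    InjOn (fun q : Amb n × ℝ => q.1 + q.2 • innerNormal Ω q.1)
      (frontier Ω ×ˢ Ico 0 (collarWidth Ω)) := by
  intro p hp q hq hpq
  have hne : (collarRadii Ω).Nonempty := ⟨0, le_rfl, by simp⟩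
  have hlt : max p.2 q.2 < sSup (collarRadii Ω) := max_lt hp.2.2 hq.2.2
  obtain ⟨ρ, hρ, hlt⟩ := exists_lt_of_lt_csSup hne hlt
  exact hρ.2 ⟨hp.1, hp.2.1, (le_max_left _ _).trans_lt hlt⟩
    ⟨hq.1, hq.2.1, (le_max_right _ _).trans_lt hlt⟩ hpq

/-- By injectivity a normal segment of length `ρ` does not return to `S`, so it stays in `Ω` and is
no longer than the diameter. Without a bound the real `sSup` would take the default value 0. -/
theorem bddAbove_collarRadii (hΩ : IsBoundedC2Domain Ω) : BddAbove (collarRadii Ω) := by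
  refine ⟨Metric.diam (closure Ω), fun ρ hρ => ?_⟩
  obtain ⟨x, hx⟩ := frontier_nonempty hΩ
  have h := definingFun_spec hΩ hx
  have hbdd : Bornology.IsBounded (closure Ω) := hΩ.isBounded.closure
  by_contra! hlt
  have hρ0 : 0 < ρ := Metric.diam_nonneg.trans_lt hlt
  set f : ℝ → Amb n := fun t => x + t • innerNormal Ω x with hf
  have hcont : Continuous f := by fun_prop
  have hdisj : Disjoint (f '' Ioo 0 ρ) (frontier Ω) := by
    rw [disjoint_left]
    rintro _ ⟨t, ht, rfl⟩ hS
    have := hρ.2 (show (x, t) ∈ frontier Ω ×ˢ Ico 0 ρ from ⟨hx, ht.1.le, ht.2⟩)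
      (show (f t, (0 : ℝ)) ∈ frontier Ω ×ˢ Ico 0 ρ from ⟨hS, le_rfl, hρ0⟩) (by simp [hf])
    exact ht.1.ne' (Prod.ext_iff.1 this).2
  have hmem : ∀ᶠ s : ℝ in 𝓝[>] 0, f s ∈ Ω := by
    refine h.eventually_mem hΩ.isOpen hx ?_
    rw [inner_gradient_left, innerNormal, h.fderiv_unit]
    exact norm_pos_iff.2 h.2.1
  obtain ⟨s, hs, hs2⟩ := (hmem.and (Ioo_mem_nhdsGT hρ0)).exists
  have hsub : f '' Ioo 0 ρ ⊆ Ω := subset_of_isPreconnected hΩ.isOpen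
    (isPreconnected_Ioo.image f hcont.continuousOn) hdisj ⟨f s, ⟨s, hs2, rfl⟩, hs⟩
  obtain ⟨t, ht1, ht2⟩ := exists_between hlt
  have ht0 : 0 < t := Metric.diam_nonneg.trans_lt ht1
  have hd := Metric.dist_le_diam_of_mem hbdd (subset_closure (hsub ⟨t, ⟨ht0, ht2⟩, rfl⟩))
    (frontier_subset_closure hx)
  rw [dist_eq_norm, hf] at hd
  simp only [add_sub_cancel_left, norm_smul, norm_innerNormal hΩ hx, mul_one, Real.norm_eq_abs,
    abs_of_pos ht0] at hd
  linarith

/-- Failure at every width `1 / (k + 1)` gives pairs with equal images. By compactness both members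
converge along a subsequence to the same `(x, 0)`, against local injectivity there. -/
theorem exists_pos_mem_collarRadii (hΩ : IsBoundedC2Domain Ω) : ∃ ρ ∈ collarRadii Ω, 0 < ρ := by
  by_contra! hcon
  have hk : ∀ k : ℕ, ∃ p q : Amb n × ℝ, p ∈ frontier Ω ×ˢ Ico 0 (1 / ((k : ℝ) + 1)) ∧
      q ∈ frontier Ω ×ˢ Ico 0 (1 / ((k : ℝ) + 1)) ∧
      p.1 + p.2 • innerNormal Ω p.1 = q.1 + q.2 • innerNormal Ω q.1 ∧ p ≠ q := by
    intro k
    by_contra! hno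
    have hpos : (0 : ℝ) < 1 / ((k : ℝ) + 1) := by positivity
    exact (hcon _ ⟨hpos.le, fun p hp q hq hpq => hno p q hp hq hpq⟩).not_gt hpos
  choose p q hp hq hpq hne using hk
  obtain ⟨x, hx, φ, hφ, hlim⟩ := (isCompact_frontier hΩ).tendsto_subseq fun k => (hp k).1
  have hinv : Tendsto (fun k => 1 / ((φ k : ℝ) + 1)) atTop (𝓝 0) :=
    tendsto_one_div_add_atTop_nhds_zero_nat.comp hφ.tendsto_atTop
  have hp2 : Tendsto (fun k => (p (φ k)).2) atTop (𝓝 0) :=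
    squeeze_zero (fun k => (hp _).2.1) (fun k => (hp _).2.2.le) hinv
  have hq2 : Tendsto (fun k => (q (φ k)).2) atTop (𝓝 0) :=
    squeeze_zero (fun k => (hq _).2.1) (fun k => (hq _).2.2.le) hinv
  have hdist : Tendsto (fun k => (q (φ k)).1 - (p (φ k)).1) atTop (𝓝 0) := by
    rw [tendsto_zero_iff_norm_tendsto_zero]
    refine squeeze_zero (fun _ => norm_nonneg _) (fun k => ?_) (by simpa using hp2.add hq2)
    have e : (q (φ k)).1 - (p (φ k)).1 = (p (φ k)).2 • innerNormal Ω (p (φ k)).1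
        - (q (φ k)).2 • innerNormal Ω (q (φ k)).1 := by
      rw [sub_eq_sub_iff_add_eq_add, add_comm _ (p (φ k)).1, hpq]
    rw [e]
    refine (norm_sub_le _ _).trans (le_of_eq ?_)
    rw [norm_smul, norm_smul, norm_innerNormal hΩ (hp _).1, norm_innerNormal hΩ (hq _).1,
      mul_one, mul_one, Real.norm_of_nonneg (hp _).2.1, Real.norm_of_nonneg (hq _).2.1]
  have hq1 : Tendsto (fun k => (q (φ k)).1) atTop (𝓝 x) := by
    simpa using hdist.add hlim
  obtain ⟨U, hU, hinj⟩ := eventually_eq_of_normalExp_eq hΩ hx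
  have e1 : ∀ᶠ k in atTop, p (φ k) ∈ U := (Tendsto.prodMk_nhds hlim hp2).eventually hU
  have e2 : ∀ᶠ k in atTop, q (φ k) ∈ U := (Tendsto.prodMk_nhds hq1 hq2).eventually hU
  obtain ⟨k, k1, k2⟩ := (e1.and e2).exists
  exact hne _ (hinj ⟨k1, (hp _).1, mem_univ _⟩ ⟨k2, (hq _).1, mem_univ _⟩ (hpq _))

theorem collarWidth_pos (hΩ : IsBoundedC2Domain Ω) : 0 < collarWidth Ω := by
  obtain ⟨ρ, hρ, hpos⟩ := exists_pos_mem_collarRadii hΩ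
  exact hpos.trans_le (le_csSup (bddAbove_collarRadii hΩ) hρ)

/-! ### Regularity of the nearest point projection in the collar -/

theorem foot_eq_of_infDist_eq (hΩ : IsBoundedC2Domain Ω) (hy : y ∈ closure Ω)
    (hd : Metric.infDist y (frontier Ω) < collarWidth Ω) (hx : x ∈ frontier Ω)
    (hxy : dist y x = Metric.infDist y (frontier Ω)) : x = foot Ω y := by
  by_cases h : y ∈ Ω
  · have e1 := eq_add_of_nearest_of_mem hΩ h hx fun z hz =>
      hxy ▸ Metric.infDist_le_dist_of_mem hz
    have e2 := foot_add_signedDist hΩ y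
    rw [signedDist_eq_infDist hΩ hy] at e2
    rw [hxy] at e1
    have := injOn_collarWidth Ω (x₁ := (x, Metric.infDist y (frontier Ω)))
      (x₂ := (foot Ω y, Metric.infDist y (frontier Ω))) ⟨hx, Metric.infDist_nonneg, hd⟩
      ⟨(foot_spec hΩ y).1, Metric.infDist_nonneg, hd⟩ (e1.symm.trans e2.symm)
    exact (Prod.ext_iff.1 this).1
  · have hyS : y ∈ frontier Ω := by rw [hΩ.isOpen.frontier_eq]; exact ⟨hy, h⟩
    have h1 := (foot_spec hΩ y).2
    rw [Metric.infDist_zero_of_mem hyS] at hxy h1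
    rw [← dist_eq_zero.1 hxy]
    exact dist_eq_zero.1 h1.symm

/-- Every cluster point of nearest points, in the compact `S`, is a nearest point of the limit, and
that one is unique in the collar. -/
theorem continuousAt_foot (hΩ : IsBoundedC2Domain Ω) (hy : y ∈ closure Ω)
    (hd : Metric.infDist y (frontier Ω) < collarWidth Ω) : ContinuousAt (foot Ω) y := by
  refine (isCompact_frontier hΩ).tendsto_nhds_of_unique_mapClusterPt
    (Eventually.of_forall fun z => (foot_spec hΩ z).1) fun x hx hcl => ?_
  refine foot_eq_of_infDist_eq hΩ hy hd hx ?_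
  have hcl2 : MapClusterPt (dist y x) (𝓝 y) fun z => dist y (foot Ω z) :=
    hcl.continuousAt_comp (f := fun w => dist y w) (by fun_prop)
  have hlim : Tendsto (fun z => dist y (foot Ω z)) (𝓝 y)
      (𝓝 (Metric.infDist y (frontier Ω))) := by
    have hlow : ∀ z, Metric.infDist y (frontier Ω) ≤ dist y (foot Ω z) := fun z =>
      Metric.infDist_le_dist_of_mem (foot_spec hΩ z).1
    have hup : ∀ z, dist y (foot Ω z) ≤ dist y z + Metric.infDist z (frontier Ω) := fun z => by
      rw [(foot_spec hΩ z).2]; exact dist_triangle _ _ _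
    refine tendsto_of_tendsto_of_tendsto_of_le_of_le tendsto_const_nhds ?_ hlow hup
    have : ContinuousAt (fun z => dist y z + Metric.infDist z (frontier Ω)) y :=
      (by fun_prop : Continuous fun z => dist y z).continuousAt.add
        (Metric.continuous_infDist_pt _).continuousAt
    simpa [ContinuousAt] using this
  exact eq_of_nhds_neBot (NeBot.mono hcl2 (inf_le_inf_left _ hlim))

/-- In the collar, the nearest point and the signed distance are of class `C¹`. -/
theorem contDiffAt_foot_signedDist (hΩ : IsBoundedC2Domain Ω) (hy : y ∈ closure Ω)
    (hd : Metric.infDist y (frontier Ω) < collarWidth Ω)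
    (hK : Metric.infDist y (frontier Ω) * secondFFSup Ω < 1) :
    ContDiffAt ℝ 1 (foot Ω) y ∧ ContDiffAt ℝ 1 (signedDist Ω) y := by
  obtain ⟨H, hH, hev⟩ := exists_local_inverse hΩ (foot_spec hΩ y).1 (t := signedDist Ω y)
    (by rwa [abs_signedDist])
  rw [foot_add_signedDist hΩ y] at hH
  have hc : Tendsto (fun z => (foot Ω z, signedDist Ω z)) (𝓝 y) (𝓝 (foot Ω y, signedDist Ω y)) :=
    (continuousAt_foot hΩ hy hd).prodMk_nhds (continuousAt_signedDist hΩ hy)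
  -- Continuity brings `(foot z, d z)` into the region where `H` inverts the exponential map, also
  -- for `z` outside `Ω`, where the collar width gives no uniqueness.
  have heq : H =ᶠ[𝓝 y] fun z => (foot Ω z, signedDist Ω z) := by
    filter_upwards [hc.eventually hev] with z hz
    have := hz (foot_spec hΩ z).1
    rwa [foot_add_signedDist hΩ z] at this
  have hC := hH.congr_of_eventuallyEq heq.symm
  exact ⟨hC.fst, hC.snd⟩

end NormalExp

/-! ### A `C¹` extension of the inner normal -/

/-- A `C¹` function that decreases from `1` to `0` on `[0, δ]`. -/
noncomputable def collarCutoff (δ t : ℝ) : ℝ := (max (δ - t) 0) ^ 2 / δ ^ 2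

theorem hasDerivAt_max_zero_sq (t : ℝ) :
    HasDerivAt (fun s : ℝ => (max s 0) ^ 2) (2 * max t 0) t := by
  rcases lt_trichotomy t 0 with h | rfl | h
  · rw [max_eq_right h.le, mul_zero]
    refine (hasDerivAt_const t (0 : ℝ)).congr_of_eventuallyEq ?_
    filter_upwards [gt_mem_nhds h] with s hs
    rw [max_eq_right hs.le]; norm_num
  · rw [max_self, mul_zero, hasDerivAt_iff_isLittleO_nhds_zero]
    have h1 : (fun s : ℝ => s ^ 2) =o[𝓝 0] fun s : ℝ => s := by
      simpa using Asymptotics.isLittleO_pow_id (𝕜 := ℝ) (n := 2) (by norm_num)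
    -- The square removes the corner at 0: the function is at most `s²`.
    refine (Asymptotics.IsBigO.of_norm_le fun s => ?_).trans_isLittleO h1
    simp only [zero_add, max_self, smul_zero, sub_zero, zero_pow two_ne_zero, norm_pow,
      Real.norm_eq_abs, sq_abs]
    rcases le_total s 0 with hs | hs
    · rw [max_eq_right hs]; nlinarith [sq_nonneg s]
    · rw [max_eq_left hs]
  · rw [max_eq_left h.le]
    have h1 : HasDerivAt (fun s : ℝ => s ^ 2) (2 * t) t := by simpa using hasDerivAt_pow 2 t
    refine h1.congr_of_eventuallyEq ?_
    filter_upwards [lt_mem_nhds h] with s hs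
    rw [max_eq_left (le_of_lt hs)]

theorem hasDerivAt_collarCutoff (δ t : ℝ) :
    HasDerivAt (collarCutoff δ) (-(2 * max (δ - t) 0) / δ ^ 2) t := by
  have h1 : HasDerivAt (fun s : ℝ => δ - s) (-1) t := by
    simpa using (hasDerivAt_id t).const_sub δ
  have h2 := ((hasDerivAt_max_zero_sq (δ - t)).comp t h1).div_const (δ ^ 2)
  rw [mul_neg_one] at h2
  exact h2

theorem contDiff_collarCutoff (δ : ℝ) : ContDiff ℝ 1 (collarCutoff δ) := by
  rw [contDiff_one_iff_deriv]
  refine ⟨fun t => (hasDerivAt_collarCutoff δ t).differentiableAt, ?_⟩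
  have : deriv (collarCutoff δ) = fun t => -(2 * max (δ - t) 0) / δ ^ 2 := by
    ext1 t; exact (hasDerivAt_collarCutoff δ t).deriv
  rw [this]
  fun_prop

theorem collarCutoff_zero {δ : ℝ} (hδ : 0 < δ) : collarCutoff δ 0 = 1 := by
  rw [collarCutoff, sub_zero, max_eq_left hδ.le, div_self (by positivity)]

theorem collarCutoff_of_le {δ t : ℝ} (h : δ ≤ t) : collarCutoff δ t = 0 := by
  rw [collarCutoff, max_eq_right (by linarith)]; simp

/-- The sign of `t` matters: the cutoff exceeds 1 for negative `t`, so the bounds on the field are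
claimed only on `closure Ω`. -/
theorem abs_collarCutoff_le {δ t : ℝ} (hδ : 0 < δ) (ht : 0 ≤ t) : |collarCutoff δ t| ≤ 1 := by
  have h0 : 0 ≤ max (δ - t) 0 := le_max_right _ _
  have h1 : max (δ - t) 0 ≤ δ := max_le (by linarith) hδ.le
  rw [collarCutoff, abs_of_nonneg (by positivity), div_le_one (by positivity)]
  exact pow_le_pow_left₀ h0 h1 2

theorem abs_deriv_collarCutoff_le {δ t : ℝ} (hδ : 0 < δ) (ht : 0 ≤ t) :
    |-(2 * max (δ - t) 0) / δ ^ 2| ≤ 2 / δ := by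
  have h0 : 0 ≤ max (δ - t) 0 := le_max_right _ _
  have h1 : max (δ - t) 0 ≤ δ := max_le (by linarith) hδ.le
  rw [neg_div, abs_neg, abs_of_nonneg (by positivity), div_le_div_iff₀ (by positivity) hδ]
  nlinarith

section Extension

variable {n : ℕ} {Ω : Set (Amb n)} {y : Amb n} {δ : ℝ}

/-- The inner normal at the nearest boundary point, cut off at distance `δ`. -/
noncomputable def collarField (Ω : Set (Amb n)) (δ : ℝ) (y : Amb n) : Amb n :=
  collarCutoff δ (signedDist Ω y) • innerNormal Ω (foot Ω y)

theorem norm_collarField_le (hΩ : IsBoundedC2Domain Ω) (hδ : 0 < δ) (hy : y ∈ closure Ω) :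
    ‖collarField Ω δ y‖ ≤ 1 := by
  rw [collarField, norm_smul, norm_innerNormal hΩ (foot_spec hΩ y).1, mul_one]
  refine abs_collarCutoff_le hδ ?_
  rw [signedDist_eq_infDist hΩ hy]
  exact Metric.infDist_nonneg

theorem collarField_of_mem_frontier (hΩ : IsBoundedC2Domain Ω) (hδ : 0 < δ)
    (hy : y ∈ frontier Ω) : collarField Ω δ y = innerNormal Ω y := by
  have h0 := Metric.infDist_zero_of_mem hy
  have h1 : signedDist Ω y = 0 := by rw [← abs_eq_zero, abs_signedDist, h0]
  have h2 := (foot_spec hΩ y).2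
  rw [h0] at h2
  rw [collarField, h1, collarCutoff_zero hδ, one_smul, ← dist_eq_zero.1 h2.symm]

theorem collarField_regular_of_le (hΩ : IsBoundedC2Domain Ω) (hδ : 0 < δ)
    (hδρ : δ < collarWidth Ω) (hδK : δ * secondFFSup Ω ≤ 1 / 2) (hy : y ∈ closure Ω)
    (hle : Metric.infDist y (frontier Ω) ≤ δ) :
    ContDiffAt ℝ 1 (collarField Ω δ) y ∧
      ‖fderiv ℝ (collarField Ω δ) y‖ ≤ 2 / δ + 2 * secondFFSup Ω := by
  set K := secondFFSup Ω with hK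
  have hK0 : 0 ≤ K := secondFFSup_nonneg
  have hdK : Metric.infDist y (frontier Ω) * K ≤ 1 / 2 :=
    (mul_le_mul_of_nonneg_right hle hK0).trans hδK
  obtain ⟨hf, hs⟩ := contDiffAt_foot_signedDist hΩ hy (hle.trans_lt hδρ) (by linarith)
  have hx := (foot_spec hΩ y).1
  set x := foot Ω y with hxdef
  have h := definingFun_spec hΩ hx
  set r := definingFun Ω x with hr
  set ν := unitGrad r with hν
  have hνc : ContDiffAt ℝ 1 ν x := h.contDiffAt_unitGrad
  have hνfc : ContDiffAt ℝ 1 (fun z => ν (foot Ω z)) y :=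
    ContDiffAt.comp (g := ν) (f := foot Ω) y hνc hf
  have hcc : ContDiffAt ℝ 1 (fun z => collarCutoff δ (signedDist Ω z)) y :=
    (contDiff_collarCutoff δ).contDiffAt.comp y hs
  have hdef : ∀ᶠ z in 𝓝 y, IsDefiningAt Ω (foot Ω z) r := hf.continuousAt.eventually h.eventually
  have hnu : ∀ᶠ z in 𝓝 y, innerNormal Ω (foot Ω z) = ν (foot Ω z) := by
    filter_upwards [hdef] with z hz using innerNormal_eq hΩ (foot_spec hΩ z).1 hz
  have heq : collarField Ω δ =ᶠ[𝓝 y]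
      fun z => collarCutoff δ (signedDist Ω z) • ν (foot Ω z) := by
    filter_upwards [hnu] with z hz
    rw [collarField, hz]
  refine ⟨(hcc.smul hνfc).congr_of_eventuallyEq heq, ?_⟩
  have hfd := (hf.differentiableAt (by simp)).hasFDerivAt
  have hsd := (hs.differentiableAt (by simp)).hasFDerivAt
  have hνd : HasFDerivAt ν (fderiv ℝ ν x) x := (hνc.differentiableAt (by simp)).hasFDerivAt
  have hνfd : HasFDerivAt (fun z => ν (foot Ω z)) (fderiv ℝ ν x ∘L fderiv ℝ (foot Ω) y) y :=
    HasFDerivAt.comp (g := ν) (f := foot Ω) y hνd hfd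
  have hcd : HasFDerivAt (fun z => collarCutoff δ (signedDist Ω z))
      ((-(2 * max (δ - signedDist Ω y) 0) / δ ^ 2) • fderiv ℝ (signedDist Ω) y) y :=
    (hasDerivAt_collarCutoff δ (signedDist Ω y)).comp_hasFDerivAt y hsd
  have hXd := (hcd.fun_smul hνfd).congr_of_eventuallyEq heq
  rw [hXd.fderiv]
  have hsy : signedDist Ω y = Metric.infDist y (frontier Ω) := signedDist_eq_infDist hΩ hy
  have hs0 : 0 ≤ signedDist Ω y := hsy ▸ Metric.infDist_nonneg
  have hνx : ‖ν x‖ = 1 := h.norm_unitGrad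
  have hrd : HasFDerivAt (fun z => r (foot Ω z)) (fderiv ℝ r x ∘L fderiv ℝ (foot Ω) y) y :=
    HasFDerivAt.comp (g := r) (f := foot Ω) y h.differentiableAt.hasFDerivAt hfd
  -- The foot stays on `S`, so its derivative takes values tangent to `S`.
  have hr0 : fderiv ℝ r x ∘L fderiv ℝ (foot Ω) y = 0 := by
    refine hrd.unique ((hasFDerivAt_const (0 : ℝ) y).congr_of_eventuallyEq ?_)
    filter_upwards [hdef] with z hz using hz.eq_zero hΩ.isOpen (foot_spec hΩ z).1
  have hid : fderiv ℝ (foot Ω) y + (signedDist Ω y • (fderiv ℝ ν x ∘L fderiv ℝ (foot Ω) y)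
      + (fderiv ℝ (signedDist Ω) y).smulRight (ν x)) = ContinuousLinearMap.id ℝ (Amb n) := by
    refine (hfd.add (hsd.fun_smul hνfd)).unique ((hasFDerivAt_id y).congr_of_eventuallyEq ?_)
    filter_upwards [hnu] with z hz
    have := foot_add_signedDist hΩ z
    rw [hz] at this
    exact this
  refine ContinuousLinearMap.opNorm_le_bound _ (by positivity) fun w => ?_
  set u := fderiv ℝ (foot Ω) y w with hu
  set s := fderiv ℝ (signedDist Ω) y w with hsw
  have e1 : u + (signedDist Ω y • fderiv ℝ ν x u + s • ν x) = w :=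
    congrArg (fun L : Amb n →L[ℝ] Amb n => L w) hid
  have e2 : fderiv ℝ r x u = 0 := congrArg (fun L : Amb n →L[ℝ] ℝ => L w) hr0
  have hun : inner ℝ (ν x) u = 0 := by
    rw [hν, unitGrad, inner_smul_left, inner_gradient_left, e2, mul_zero]
  have hDn : inner ℝ (ν x) (fderiv ℝ ν x u) = 0 := h.inner_fderiv_unitGrad_self u
  have hDb : ‖fderiv ℝ ν x u‖ ≤ K * ‖u‖ := norm_fderiv_unitGrad_le hΩ hx h hun
  -- Normal part of the differentiated identity; the tangential part then gives `‖u‖ - ‖u‖ / 2 ≤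
  -- ‖w‖`.
  have hsv : s = inner ℝ (ν x) w := by
    rw [← e1]
    simp [inner_add_right, inner_smul_right, hun, hDn, hνx]
  have hsb : |s| ≤ ‖w‖ := by
    rw [hsv]
    simpa [hνx] using abs_real_inner_le_norm (ν x) w
  have hub : ‖u‖ ≤ 2 * ‖w‖ := by
    have e3 : w - s • ν x = u + signedDist Ω y • fderiv ℝ ν x u := by rw [← e1]; abel
    have h1 : ‖w - s • ν x‖ ≤ ‖w‖ := by
      refine le_of_sq_le_sq ?_ (norm_nonneg _)
      rw [norm_sub_sq_real, inner_smul_right, real_inner_comm, ← hsv, norm_smul, hνx, mul_one,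
        Real.norm_eq_abs, sq_abs]
      nlinarith [sq_nonneg s]
    have h2 : ‖signedDist Ω y • fderiv ℝ ν x u‖ ≤ 1 / 2 * ‖u‖ := by
      rw [norm_smul, Real.norm_of_nonneg hs0, hsy]
      calc Metric.infDist y (frontier Ω) * ‖fderiv ℝ ν x u‖
          ≤ Metric.infDist y (frontier Ω) * (K * ‖u‖) :=
            mul_le_mul_of_nonneg_left hDb Metric.infDist_nonneg
        _ = Metric.infDist y (frontier Ω) * K * ‖u‖ := by ring
        _ ≤ 1 / 2 * ‖u‖ := mul_le_mul_of_nonneg_right hdK (norm_nonneg _)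
    have h3 : ‖u‖ - ‖signedDist Ω y • fderiv ℝ ν x u‖ ≤ ‖w - s • ν x‖ := by
      rw [e3]
      have := norm_sub_norm_le u (-(signedDist Ω y • fderiv ℝ ν x u))
      rwa [norm_neg, sub_neg_eq_add] at this
    linarith
  have hval : (collarCutoff δ (signedDist Ω y) • (fderiv ℝ ν x ∘L fderiv ℝ (foot Ω) y)
      + ((-(2 * max (δ - signedDist Ω y) 0) / δ ^ 2) • fderiv ℝ (signedDist Ω) y).smulRight
        (ν (foot Ω y))) w = collarCutoff δ (signedDist Ω y) • fderiv ℝ ν x u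
      + ((-(2 * max (δ - signedDist Ω y) 0) / δ ^ 2) * s) • ν x := rfl
  rw [hval]
  have b1 : ‖collarCutoff δ (signedDist Ω y) • fderiv ℝ ν x u‖ ≤ 1 * (K * (2 * ‖w‖)) := by
    rw [norm_smul]
    exact mul_le_mul (abs_collarCutoff_le hδ hs0)
      (hDb.trans (mul_le_mul_of_nonneg_left hub hK0)) (norm_nonneg _) zero_le_one
  have b2 : ‖((-(2 * max (δ - signedDist Ω y) 0) / δ ^ 2) * s) • ν x‖ ≤ 2 / δ * ‖w‖ := by
    rw [norm_smul, hνx, mul_one, norm_mul]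
    exact mul_le_mul (abs_deriv_collarCutoff_le hδ hs0) hsb (abs_nonneg _) (by positivity)
  calc _ ≤ _ := norm_add_le _ _
    _ ≤ 1 * (K * (2 * ‖w‖)) + 2 / δ * ‖w‖ := add_le_add b1 b2
    _ = (2 / δ + 2 * K) * ‖w‖ := by ring

theorem collarField_regular (hΩ : IsBoundedC2Domain Ω) (hδ : 0 < δ)
    (hδρ : δ < collarWidth Ω) (hδK : δ * secondFFSup Ω ≤ 1 / 2) (hy : y ∈ closure Ω) :
    ContDiffAt ℝ 1 (collarField Ω δ) y ∧
      ‖fderiv ℝ (collarField Ω δ) y‖ ≤ 2 / δ + 2 * secondFFSup Ω := by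
  rcases le_or_gt (Metric.infDist y (frontier Ω)) δ with hle | hlt
  · exact collarField_regular_of_le hΩ hδ hδρ hδK hy hle
  · have heq : collarField Ω δ =ᶠ[𝓝 y] fun _ => 0 := by
      filter_upwards [(continuousAt_signedDist hΩ hy).eventually_const_lt
        (by rwa [signedDist_eq_infDist hΩ hy])] with z hz
      rw [collarField, collarCutoff_of_le hz.le, zero_smul]
    refine ⟨contDiffAt_const.congr_of_eventuallyEq heq, ?_⟩
    rw [heq.fderiv_eq, fderiv_const_apply, norm_zero]
    have := secondFFSup_nonneg (Ω := Ω)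
    positivity

/-- The inner normal extends to a `C¹` vector field, with bounds on `closure Ω` in terms of the
second fundamental form and the collar width. -/
theorem exists_normal_extension (hΩ : IsBoundedC2Domain Ω) (hδ : 0 < δ)
    (hδρ : δ < collarWidth Ω) (hδK : δ * secondFFSup Ω ≤ 1 / 2) :
    ∃ X : Amb n → Amb n, ContDiff ℝ 1 X ∧ (∀ x ∈ frontier Ω, X x = innerNormal Ω x) ∧
      ∀ y ∈ closure Ω, ‖X y‖ ≤ 1 ∧ ‖fderiv ℝ X y‖ ≤ 2 / δ + 2 * secondFFSup Ω := by
  have hUo : IsOpen {z | ContDiffAt ℝ 1 (collarField Ω δ) z} :=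
    isOpen_iff_mem_nhds.2 fun z hz => ContDiffAt.eventually hz (by simp)
  have hsub : closure Ω ⊆ {z | ContDiffAt ℝ 1 (collarField Ω δ) z} := fun z hz =>
    (collarField_regular hΩ hδ hδρ hδK hz).1
  have hcomp : IsCompact (closure Ω) :=
    Metric.isCompact_of_isClosed_isBounded isClosed_closure hΩ.isBounded.closure
  -- The collar field is `C¹` only near `closure Ω`. A smooth function equal to 1 there and
  -- vanishing off `T` makes it global without changing values or derivatives on `closure Ω`.
  obtain ⟨T, hT, hT1, hT2⟩ := exists_compact_between hcomp hUo hsub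
  obtain ⟨χ, hχ1, hχ0, -⟩ := exists_contMDiffMap_one_nhds_of_subset_interior
    (n := ⊤) (modelWithCornersSelf ℝ (Amb n)) isClosed_closure hT1
  have hχ : ContDiff ℝ 1 χ := χ.contMDiff.contDiff.of_le (by simp)
  have heq : ∀ y ∈ closure Ω, (fun z => χ z • collarField Ω δ z) =ᶠ[𝓝 y] collarField Ω δ :=
    fun y hy => by
      filter_upwards [hχ1.filter_mono (nhds_le_nhdsSet hy)] with z hz
      rw [hz, one_smul]
  refine ⟨fun z => χ z • collarField Ω δ z, ?_, fun x hx => ?_, fun y hy => ⟨?_, ?_⟩⟩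
  · rw [contDiff_iff_contDiffAt]
    intro z
    by_cases hz : z ∈ T
    · exact hχ.contDiffAt.smul (hT2 hz)
    · refine contDiffAt_const (c := 0).congr_of_eventuallyEq ?_
      filter_upwards [hT.isClosed.isOpen_compl.mem_nhds hz] with w hw
      rw [hχ0 w hw, zero_smul]
  · exact (heq x (frontier_subset_closure hx)).eq_of_nhds.trans
      (collarField_of_mem_frontier hΩ hδ hx)
  · refine (congrArg norm (heq y hy).eq_of_nhds).trans_le ?_
    exact norm_collarField_le hΩ hδ hy
  · rw [(heq y hy).fderiv_eq]
    exact (collarField_regular hΩ hδ hδρ hδK hy).2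

end Extension

/-! ### The first variation identity for vector fields -/

section FirstVariation

variable {n : ℕ} {Ω : Set (Amb n)} {β : Amb n → ℝ} {V Γ : Measure (Amb n × Amb n)}
  {W : Fin (n + 1) → Fin (n + 1) → Amb n × Amb n → ℝ} {X : Amb n → Amb n}

/-- The divergence of `X` at `x` along the hyperplane `v^⊥`, at `z = (x, v)`. -/
noncomputable def tangentialDiv (X : Amb n → Amb n) (z : Amb n × Amb n) : ℝ :=
  ∑ i, ∑ j, ((if i = j then 1 else 0) - z.2 i * z.2 j) * fderiv ℝ X z.1 (coordVec j) i

/-- The curvature term of the first variation in direction `X`. -/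
noncomputable def curvatureTerm (W : Fin (n + 1) → Fin (n + 1) → Amb n × Amb n → ℝ)
    (X : Amb n → Amb n) (z : Amb n × Amb n) : ℝ :=
  ∑ i, (∑ r, (W r r z * z.2 i + W r i z * z.2 r)) * X z.1 i

theorem norm_coordVec (i : Fin (n + 1)) : ‖(coordVec i : Amb n)‖ = 1 := by
  simp [coordVec]

theorem abs_apply_le_norm (u : Amb n) (i : Fin (n + 1)) : |u i| ≤ ‖u‖ := by
  simpa using PiLp.norm_apply_le u i

theorem abs_tangentialDiv_le {z : Amb n × Amb n} (hz : ‖z.2‖ = 1) {L : ℝ}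
    (hL : ‖fderiv ℝ X z.1‖ ≤ L) : |tangentialDiv X z| ≤ 2 * ((n : ℝ) + 1) ^ 2 * L := by
  have hL0 : 0 ≤ L := (norm_nonneg _).trans hL
  have hterm : ∀ i j, |((if i = j then 1 else 0) - z.2 i * z.2 j)
      * fderiv ℝ X z.1 (coordVec j) i| ≤ 2 * L := by
    intro i j
    rw [abs_mul]
    refine mul_le_mul ?_ ?_ (abs_nonneg _) (by norm_num)
    · refine (abs_sub _ _).trans ?_
      have h1 : |(if i = j then (1 : ℝ) else 0)| ≤ 1 := by split_ifs <;> simp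
      have h2 : |z.2 i * z.2 j| ≤ 1 := by
        rw [abs_mul]
        exact mul_le_one₀ (hz ▸ abs_apply_le_norm _ _) (abs_nonneg _) (hz ▸ abs_apply_le_norm _ _)
      linarith
    · refine (abs_apply_le_norm _ _).trans (((fderiv ℝ X z.1).le_opNorm _).trans ?_)
      rwa [norm_coordVec, mul_one]
  refine (Finset.abs_sum_le_sum_abs _ _).trans ((Finset.sum_le_sum fun i _ =>
    (Finset.abs_sum_le_sum_abs _ _).trans (Finset.sum_le_sum fun j _ => hterm i j)).trans ?_)
  simp only [Finset.sum_const, Finset.card_univ, Fintype.card_fin, nsmul_eq_mul]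
  push_cast
  exact le_of_eq (by ring)

theorem abs_le_frobNorm (W : Fin (n + 1) → Fin (n + 1) → Amb n × Amb n → ℝ)
    (z : Amb n × Amb n) (i a : Fin (n + 1)) : |W i a z| ≤ frobNorm W z := by
  refine Real.abs_le_sqrt ?_
  have h1 : W i a z ^ 2 ≤ ∑ b, W i b z ^ 2 :=
    Finset.single_le_sum (f := fun b => W i b z ^ 2) (fun b _ => sq_nonneg _) (Finset.mem_univ a)
  exact h1.trans (Finset.single_le_sum (f := fun c => ∑ b, W c b z ^ 2)
    (fun c _ => Finset.sum_nonneg fun b _ => sq_nonneg _) (Finset.mem_univ i))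

theorem frobNorm_nonneg (W : Fin (n + 1) → Fin (n + 1) → Amb n × Amb n → ℝ)
    (z : Amb n × Amb n) : 0 ≤ frobNorm W z := Real.sqrt_nonneg _

theorem abs_curvatureTerm_le {z : Amb n × Amb n} (hz : ‖z.2‖ = 1) {B : ℝ}
    (hB : ‖X z.1‖ ≤ B) :
    |curvatureTerm W X z| ≤ 2 * ((n : ℝ) + 1) ^ 2 * (B * frobNorm W z) := by
  have hF := frobNorm_nonneg W z
  have hv : ∀ i, |z.2 i| ≤ 1 := fun i => hz ▸ abs_apply_le_norm _ _
  have hterm : ∀ i r, |W r r z * z.2 i + W r i z * z.2 r| ≤ 2 * frobNorm W z := by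
    intro i r
    refine (abs_add_le _ _).trans ?_
    rw [abs_mul, abs_mul]
    have h1 := mul_le_mul (abs_le_frobNorm W z r r) (hv i) (abs_nonneg _) hF
    have h2 := mul_le_mul (abs_le_frobNorm W z r i) (hv r) (abs_nonneg _) hF
    linarith
  have hi : ∀ i, |(∑ r, (W r r z * z.2 i + W r i z * z.2 r)) * X z.1 i|
      ≤ (((n : ℝ) + 1) * (2 * frobNorm W z)) * B := by
    intro i
    rw [abs_mul]
    refine mul_le_mul ?_ ((abs_apply_le_norm _ _).trans hB) (abs_nonneg _) (by positivity)
    refine (Finset.abs_sum_le_sum_abs _ _).trans ((Finset.sum_le_sum fun r _ => hterm i r).trans ?_)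
    simp
  refine (Finset.abs_sum_le_sum_abs _ _).trans ((Finset.sum_le_sum fun i _ => hi i).trans ?_)
  simp only [Finset.sum_const, Finset.card_univ, Fintype.card_fin, nsmul_eq_mul]
  push_cast
  exact le_of_eq (by ring)

theorem norm_conormal_le (Ω : Set (Amb n)) (z : Amb n × Amb n) : ‖conormal Ω z‖ ≤ 1 := by
  rw [conormal, norm_smul, norm_inv, norm_norm]
  exact inv_mul_le_one

/-- Both `⟨ν, v^⊥ν⟩` and `|v^⊥ν|²` equal `1 - ⟨v, ν⟩² = sin² β`. The sign of `⟨v, ν⟩` plays no role,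
and `sin β > 0` selects the root. -/
theorem inner_innerNormal_conormal (hΩ : IsBoundedC2Domain Ω) (hβ : IsAngle Ω β)
    {z : Amb n × Amb n} (hz : z ∈ capBundle Ω β) :
    inner ℝ (innerNormal Ω z.1) (conormal Ω z) = Real.sin (β z.1) := by
  obtain ⟨hzS, hv, hc⟩ := hz
  have hν := norm_innerNormal hΩ hzS
  have hsin := Real.sin_pos_of_mem_Ioo (hβ.mem_Ioo _ hzS)
  have hsq : (inner ℝ z.2 (innerNormal Ω z.1)) ^ 2 = Real.cos (β z.1) ^ 2 :=
    sq_eq_sq_iff_abs_eq_abs _ _ |>.2 hc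
  have h1 : inner ℝ (innerNormal Ω z.1) (projPerp z.2 (innerNormal Ω z.1))
      = Real.sin (β z.1) ^ 2 := by
    rw [projPerp, inner_sub_right, inner_smul_right, real_inner_self_eq_norm_sq, hν,
      real_inner_comm, ← sq, real_inner_comm, Real.sin_sq, ← hsq, one_pow]
  have h2 : ‖projPerp z.2 (innerNormal Ω z.1)‖ = Real.sin (β z.1) := by
    have : ‖projPerp z.2 (innerNormal Ω z.1)‖ ^ 2 = Real.sin (β z.1) ^ 2 := by
      rw [projPerp, norm_sub_sq_real, inner_smul_right, norm_smul, hν, hv, Real.sin_sq, ← hsq,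
        real_inner_comm, Real.norm_eq_abs, mul_one, sq_abs, one_pow]
      rw [real_inner_comm]; ring
    exact (sq_eq_sq₀ (norm_nonneg _) hsin.le).1 this
  rw [conormal, inner_smul_right, h1, h2]
  field_simp

theorem ae_mem_capBundle (hΓ : IsCapillaryMeasure Ω β Γ) : ∀ᵐ z ∂Γ, z ∈ capBundle Ω β :=
  mem_ae_iff.2 hΓ.concentrated

theorem isCompact_prod_sphere {K : Set (Amb n)} (hK : IsCompact K) :
    IsCompact (K ×ˢ Metric.sphere (0 : Amb n) 1) := hK.prod (isCompact_sphere _ _)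

theorem isFiniteMeasure_of_ae_mem_compact {α : Type*} [TopologicalSpace α] [MeasurableSpace α]
    {μ : Measure α} [IsLocallyFiniteMeasure μ] {K : Set α} (hK : IsCompact K)
    (h : ∀ᵐ z ∂μ, z ∈ K) : IsFiniteMeasure μ := by
  refine ⟨(measure_univ_le_add_compl K).trans_lt ?_⟩
  have h0 : μ Kᶜ = 0 := h
  rw [h0, add_zero]
  exact hK.measure_lt_top

theorem isFiniteMeasure_of_isCapillaryMeasure (hΩ : IsBoundedC2Domain Ω)
    (hΓ : IsCapillaryMeasure Ω β Γ) : IsFiniteMeasure Γ := by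
  have := hΓ.isLocallyFinite
  refine isFiniteMeasure_of_ae_mem_compact (isCompact_prod_sphere (isCompact_frontier hΩ)) ?_
  filter_upwards [ae_mem_capBundle hΓ] with z hz
  exact ⟨hz.1, by simpa using hz.2.1⟩

theorem ae_fst_mem_and_norm_snd (hV : IsOrientedVarifold V) {K : Set (Amb n)} (hK : IsClosed K)
    (h : weight V Kᶜ = 0) : ∀ᵐ z ∂V, z.1 ∈ K ∧ ‖z.2‖ = 1 := by
  rw [weight, Measure.map_apply measurable_fst hK.isOpen_compl.measurableSet] at h
  have h1 : ∀ᵐ z ∂V, z.1 ∈ K := h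
  have h2 : ∀ᵐ z ∂V, ‖z.2‖ = 1 := hV.unit
  exact h1.and h2

theorem isFiniteMeasure_of_isOrientedVarifold (hV : IsOrientedVarifold V) {K : Set (Amb n)}
    (hK : IsCompact K) (h : weight V Kᶜ = 0) : IsFiniteMeasure V := by
  have := hV.isLocallyFinite
  refine isFiniteMeasure_of_ae_mem_compact (isCompact_prod_sphere hK) ?_
  filter_upwards [ae_fst_mem_and_norm_snd hV hK.isClosed h] with z hz
  exact ⟨hz.1, by simpa using hz.2⟩

/-- `innerNormal` is controlled only on `S`, where it is continuous and where `Γ` is concentrated.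
-/
theorem aestronglyMeasurable_conormal (hΩ : IsBoundedC2Domain Ω)
    (hΓ : IsCapillaryMeasure Ω β Γ) : AEStronglyMeasurable (conormal Ω) Γ := by
  have hms : MeasurableSet (frontier Ω ×ˢ (univ : Set (Amb n))) :=
    isClosed_frontier.measurableSet.prod MeasurableSet.univ
  have hrestr : Γ.restrict (frontier Ω ×ˢ univ) = Γ :=
    Measure.restrict_eq_self_of_ae_mem
      ((ae_mem_capBundle hΓ).mono fun z hz => ⟨hz.1, mem_univ _⟩)
  have hc : ContinuousOn (fun z : Amb n × Amb n => innerNormal Ω z.1) (frontier Ω ×ˢ univ) :=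
    (innerNormal_continuousOn hΩ).comp continuousOn_fst fun z hz => hz.1
  have h1 : AEMeasurable (fun z : Amb n × Amb n => innerNormal Ω z.1) Γ := by
    rw [← hrestr]; exact (hc.aemeasurable hms)
  have h2 : AEMeasurable (fun z : Amb n × Amb n => projPerp z.2 (innerNormal Ω z.1)) Γ :=
    h1.sub (AEMeasurable.fun_smul (measurable_snd.aemeasurable.inner (𝕜 := ℝ) h1) measurable_snd.aemeasurable)
  exact (h2.norm.inv.smul h2).aestronglyMeasurable

theorem integrable_inner_conormal (hΩ : IsBoundedC2Domain Ω) (hΓ : IsCapillaryMeasure Ω β Γ)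
    {Y : Amb n × Amb n → ℝ} (hY : Continuous Y) (hYc : HasCompactSupport Y) (i : Fin (n + 1)) :
    Integrable (fun z => Y z * conormal Ω z i) Γ := by
  have := isFiniteMeasure_of_isCapillaryMeasure hΩ hΓ
  have hm : AEStronglyMeasurable (fun z => conormal Ω z i) Γ :=
    (EuclideanSpace.proj (𝕜 := ℝ) i).continuous.comp_aestronglyMeasurable
      (aestronglyMeasurable_conormal hΩ hΓ)
  exact (hY.integrable_of_hasCompactSupport hYc).mul_bdd (c := 1) hm
    (Eventually.of_forall fun z =>
      (abs_apply_le_norm _ _).trans (norm_conormal_le Ω z))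

/-- The first variation identity tested with a vector field. -/
theorem HasCurvatureAlong.identity_vectorField (hΩ : IsBoundedC2Domain Ω)
    (hV : IsOrientedVarifold V) (hVΩ : weight V (closure Ω)ᶜ = 0)
    (hΓ : IsCapillaryMeasure Ω β Γ) (hW : HasCurvatureAlong Ω V Γ W) (hX : ContDiff ℝ 1 X) :
    Integrable (fun z => tangentialDiv X z - curvatureTerm W X z) V ∧
    Integrable (fun z => inner ℝ (X z.1) (conormal Ω z)) Γ ∧
    ∫ z, (tangentialDiv X z - curvatureTerm W X z) ∂V
      = -∫ z, inner ℝ (X z.1) (conormal Ω z) ∂Γ := by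
  obtain ⟨R, hR⟩ := hΩ.isBounded.closure.subset_closedBall (0 : Amb n)
  set ρ : ℝ := max R 1 + 1 with hρ
  have hρ0 : 0 < ρ := by positivity
  -- Equal to 1 near `closure Ω × S^n`, which contains almost all of both measures, so the cutoff
  -- leaves values and first derivatives of the test functions unchanged there.
  let χ : ContDiffBump (0 : Amb n × Amb n) := ⟨ρ, ρ + 1, hρ0, by linarith⟩
  set φ : Fin (n + 1) → Amb n × Amb n → ℝ := fun i z => χ z * X z.1 i with hφ
  have hXi : ∀ i, ContDiff ℝ 1 fun z : Amb n × Amb n => X z.1 i := fun i =>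
    (EuclideanSpace.proj (𝕜 := ℝ) i).contDiff.comp (hX.comp contDiff_fst)
  have hφc : ∀ i, ContDiff ℝ 1 (φ i) := fun i => χ.contDiff.mul (hXi i)
  have hφs : ∀ i, HasCompactSupport (φ i) := fun i => χ.hasCompactSupport.mul_right
  have hgood : ∀ z : Amb n × Amb n, z.1 ∈ closure Ω → ‖z.2‖ = 1 → ∀ i,
      φ i =ᶠ[𝓝 z] fun z => X z.1 i := by
    intro z hz1 hz2 i
    have h1 : ‖z.1‖ ≤ R := by simpa using hR hz1
    have hzb : z ∈ Metric.ball (0 : Amb n × Amb n) χ.rIn := by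
      rw [mem_ball_zero_iff, Prod.norm_def]
      refine max_lt ?_ ?_
      · exact (h1.trans (le_max_left R 1)).trans_lt (lt_add_one _)
      · rw [hz2]; exact (le_max_right R 1).trans_lt (lt_add_one _)
    filter_upwards [χ.eventuallyEq_one_of_mem_ball hzb] with w hw
    simp only [hφ, hw, Pi.one_apply, one_mul]
  have hint : ∀ z : Amb n × Amb n, z.1 ∈ closure Ω → ‖z.2‖ = 1 →
      ∑ i, variationIntegrand W (φ i) i z = tangentialDiv X z - curvatureTerm W X z := by
    intro z hz1 hz2
    rw [tangentialDiv, curvatureTerm, ← Finset.sum_sub_distrib]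
    refine Finset.sum_congr rfl fun i _ => ?_
    have hp : HasFDerivAt (fun u : Amb n => u i)
        (EuclideanSpace.proj i : Amb n →L[ℝ] ℝ) (X z.1) :=
      (EuclideanSpace.proj i : Amb n →L[ℝ] ℝ).hasFDerivAt
    have hXd : HasFDerivAt X (fderiv ℝ X z.1) z.1 :=
      (hX.differentiable one_ne_zero z.1).hasFDerivAt
    have hXf : HasFDerivAt (fun z : Amb n × Amb n => X z.1)
        (fderiv ℝ X z.1 ∘L ContinuousLinearMap.fst ℝ (Amb n) (Amb n)) z :=
      HasFDerivAt.comp (g := X) (f := Prod.fst) z hXd hasFDerivAt_fst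
    have hd : HasFDerivAt (fun z : Amb n × Amb n => X z.1 i)
        ((EuclideanSpace.proj i : Amb n →L[ℝ] ℝ) ∘L (fderiv ℝ X z.1 ∘L
          ContinuousLinearMap.fst ℝ (Amb n) (Amb n))) z :=
      HasFDerivAt.comp (g := fun u : Amb n => u i) (f := fun z : Amb n × Amb n => X z.1) z hp hXf
    have hf := (hgood z hz1 hz2 i).fderiv_eq (𝕜 := ℝ)
    rw [hd.fderiv] at hf
    rw [variationIntegrand, hf, (hgood z hz1 hz2 i).eq_of_nhds]
    simp
  have haeV := ae_fst_mem_and_norm_snd hV isClosed_closure hVΩ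
  have hVeq : (fun z => ∑ i, variationIntegrand W (φ i) i z) =ᵐ[V]
      fun z => tangentialDiv X z - curvatureTerm W X z := by
    filter_upwards [haeV] with z hz using hint z hz.1 hz.2
  have hΓeq : (fun z => ∑ i, φ i z * conormal Ω z i) =ᵐ[Γ]
      fun z => inner ℝ (X z.1) (conormal Ω z) := by
    filter_upwards [ae_mem_capBundle hΓ] with z hz
    simp only [fun i => (hgood z (frontier_subset_closure hz.1) hz.2.1 i).eq_of_nhds]
    rw [real_inner_comm]
    simp [PiLp.inner_apply]
  have hi : ∀ i ∈ Finset.univ, Integrable (fun z => variationIntegrand W (φ i) i z) V :=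
    fun i _ => hW.integrable (φ i) (hφc i) (hφs i) i
  have hi' : ∀ i ∈ Finset.univ, Integrable (fun z => φ i z * conormal Ω z i) Γ :=
    fun i _ => integrable_inner_conormal hΩ hΓ (hφc i).continuous (hφs i) i
  refine ⟨(integrable_finsetSum _ hi).congr hVeq, (integrable_finsetSum _ hi').congr hΓeq, ?_⟩
  rw [← integral_congr_ae hVeq, ← integral_congr_ae hΓeq, integral_finsetSum _ hi,
    integral_finsetSum _ hi', ← Finset.sum_neg_distrib]
  exact Finset.sum_congr rfl fun i _ => hW.identity (φ i) (hφc i) (hφs i) i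

end FirstVariation

/-! ### Absorption inequality and the two integral estimates -/

section Estimates

variable {n : ℕ} {Ω : Set (Amb n)} {β : Amb n → ℝ} {V Γ : Measure (Amb n × Amb n)}
  {W : Fin (n + 1) → Fin (n + 1) → Amb n × Amb n → ℝ} {p : ℝ}

/-- If `a > ε`, then `a^(1-p) ≤ ε^(1-p)` because `1 - p ≤ 0`. This plays the role of Young's
inequality and includes `p = 1`. -/
theorem le_add_rpow_mul_rpow {a ε p : ℝ} (ha : 0 ≤ a) (hε : 0 < ε) (hp : 1 ≤ p) :
    a ≤ ε + ε ^ (1 - p) * a ^ p := by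
  rcases le_or_gt a ε with h | h
  · have : 0 ≤ ε ^ (1 - p) * a ^ p := by positivity
    linarith
  · have ha0 : 0 < a := hε.trans h
    calc a = a ^ (1 - p) * a ^ p := by
          rw [← Real.rpow_add ha0]; simp
      _ ≤ ε ^ (1 - p) * a ^ p :=
          mul_le_mul_of_nonneg_right (Real.rpow_le_rpow_of_nonpos hε h.le (by linarith))
            (by positivity)
      _ ≤ _ := by linarith

theorem aemeasurable_frobNorm (hW : ∀ i a, AEMeasurable (W i a) V) :
    AEMeasurable (frobNorm W) V := by
  unfold frobNorm
  refine Real.continuous_sqrt.measurable.comp_aemeasurable ?_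
  exact Finset.aemeasurable_fun_sum _ fun i _ =>
    Finset.aemeasurable_fun_sum _ fun a _ => (hW i a).pow_const 2

theorem integrable_frobNorm_rpow (hW : ∀ i a, AEMeasurable (W i a) V)
    (hE : curvatureEnergy p V W ≠ ⊤) : Integrable (fun z => frobNorm W z ^ p) V := by
  refine ⟨((aemeasurable_frobNorm hW).pow_const p).aestronglyMeasurable, ?_⟩
  rw [hasFiniteIntegral_iff_ofReal
    (Eventually.of_forall fun z => Real.rpow_nonneg (frobNorm_nonneg W z) p)]
  exact hE.lt_top

theorem integral_frobNorm_rpow (hW : ∀ i a, AEMeasurable (W i a) V)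
    (hE : curvatureEnergy p V W ≠ ⊤) :
    ENNReal.ofReal (∫ z, frobNorm W z ^ p ∂V) = curvatureEnergy p V W :=
  ofReal_integral_eq_lintegral_ofReal (integrable_frobNorm_rpow hW hE)
    (Eventually.of_forall fun z => Real.rpow_nonneg (frobNorm_nonneg W z) p)

theorem tangentialDiv_sub_const (x₀ : Amb n) {z : Amb n × Amb n} (hz : ‖z.2‖ = 1) :
    tangentialDiv (fun x => x - x₀) z = n := by
  have hd : fderiv ℝ (fun x : Amb n => x - x₀) z.1 = ContinuousLinearMap.id ℝ (Amb n) := by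
    rw [fderiv_sub_const]; exact fderiv_id
  have hn : ∑ i, z.2 i * z.2 i = 1 := by
    have := EuclideanSpace.norm_sq_eq z.2
    rw [hz] at this
    simpa [← sq] using this.symm
  simp only [tangentialDiv, hd, coordVec, ContinuousLinearMap.id_apply, PiLp.single_apply,
    mul_ite, mul_one, mul_zero, Finset.sum_ite_eq, Finset.mem_univ, if_true,
    Finset.sum_sub_distrib, hn]
  simp

/-- The mass is controlled by the boundary measure and the curvature. -/
theorem mass_le_boundary_add_energy (hn : 1 ≤ n) (hp : 1 ≤ p) (hΩ : IsBoundedC2Domain Ω)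
    (hV : IsOrientedVarifold V) (hVΩ : weight V (closure Ω)ᶜ = 0)
    (hΓ : IsCapillaryMeasure Ω β Γ) (hW : HasCurvatureAlong Ω V Γ W)
    (hE : curvatureEnergy p V W ≠ ⊤) {ε : ℝ} (hε : 0 < ε)
    (hεD : 2 * ((n : ℝ) + 1) ^ 2 * (Metric.diam Ω * ε) ≤ 1 / 2) :
    V.real univ ≤ 2 * Metric.diam Ω * Γ.real univ
      + 4 * ((n : ℝ) + 1) ^ 2 * Metric.diam Ω * ε ^ (1 - p) * ∫ z, frobNorm W z ^ p ∂V := by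
  obtain ⟨x₀, hx₀⟩ := hΩ.isConnected.nonempty
  have hcomp : IsCompact (closure Ω) :=
    Metric.isCompact_of_isClosed_isBounded isClosed_closure hΩ.isBounded.closure
  have := isFiniteMeasure_of_isOrientedVarifold hV hcomp hVΩ
  have := isFiniteMeasure_of_isCapillaryMeasure hΩ hΓ
  set D := Metric.diam Ω with hD
  have hD0 : 0 ≤ D := Metric.diam_nonneg
  have hdist : ∀ x ∈ closure Ω, ‖x - x₀‖ ≤ D := fun x hx => by
    rw [← dist_eq_norm, hD, ← Metric.diam_closure]
    exact Metric.dist_le_diam_of_mem hΩ.isBounded.closure hx (subset_closure hx₀)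
  obtain ⟨hi, -, hid⟩ := hW.identity_vectorField hΩ hV hVΩ hΓ
    (X := fun x => x - x₀) (contDiff_id.sub contDiff_const)
  have hF := integrable_frobNorm_rpow hW.aemeasurable hE
  set N : ℝ := 2 * ((n : ℝ) + 1) ^ 2 with hN
  have hN0 : 0 < N := by positivity
  have hεF : Integrable (fun z => ε + ε ^ (1 - p) * frobNorm W z ^ p) V :=
    (integrable_const ε).add (hF.const_mul _)
  have hNεF : Integrable (fun z => N * (D * (ε + ε ^ (1 - p) * frobNorm W z ^ p))) V :=
    (hεF.const_mul D).const_mul N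
  have hlow : (∫ z, ((n : ℝ) - N * (D * (ε + ε ^ (1 - p) * frobNorm W z ^ p))) ∂V)
      ≤ ∫ z, (tangentialDiv (fun x => x - x₀) z - curvatureTerm W (fun x => x - x₀) z) ∂V := by
    refine integral_mono_ae ?_ hi ?_
    · exact (integrable_const _).sub hNεF
    · filter_upwards [ae_fst_mem_and_norm_snd hV isClosed_closure hVΩ] with z hz
      rw [tangentialDiv_sub_const x₀ hz.2]
      have h1 := abs_curvatureTerm_le (W := W) (X := fun x => x - x₀) hz.2 (hdist _ hz.1)
      have h2 := le_add_rpow_mul_rpow (frobNorm_nonneg W z) hε hp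
      have h3 := mul_le_mul_of_nonneg_left (mul_le_mul_of_nonneg_left h2 hD0) hN0.le
      have h4 := le_abs_self (curvatureTerm W (fun x => x - x₀) z)
      linarith
  have hcomp1 : (∫ z, ((n : ℝ) - N * (D * (ε + ε ^ (1 - p) * frobNorm W z ^ p))) ∂V)
      = n * V.real univ - N * (D * (ε * V.real univ
        + ε ^ (1 - p) * ∫ z, frobNorm W z ^ p ∂V)) := by
    rw [integral_sub (integrable_const _) hNεF, integral_const_mul, integral_const_mul, integral_add (integrable_const ε) (hF.const_mul _),
      integral_const_mul, integral_const, integral_const, smul_eq_mul, smul_eq_mul]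
    ring
  have hup : ‖∫ z, inner ℝ (z.1 - x₀) (conormal Ω z) ∂Γ‖ ≤ D * Γ.real univ := by
    refine norm_integral_le_of_norm_le_const ?_
    filter_upwards [ae_mem_capBundle hΓ] with z hz
    refine (norm_inner_le_norm _ _).trans ?_
    have := mul_le_mul (hdist z.1 (frontier_subset_closure hz.1)) (norm_conormal_le Ω z)
      (norm_nonneg _) hD0
    rwa [mul_one] at this
  -- The mass has coefficient `n - N D ε ≥ 1 - 1/2`; dividing by it produces the factor 2 in the
  -- conclusion.
  rw [hcomp1, hid] at hlow
  have h5 := neg_le_of_abs_le hup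
  have hM : 0 ≤ V.real univ := measureReal_nonneg
  have hn' : (1 : ℝ) ≤ n := by exact_mod_cast hn
  have h6 := mul_le_mul_of_nonneg_right hεD hM
  have h7 := mul_le_mul_of_nonneg_right hn' hM
  have h8 : 4 * ((n : ℝ) + 1) ^ 2 = 2 * N := by rw [hN]; ring
  rw [h8]
  nlinarith

/-- The boundary measure is controlled by the mass and the curvature. -/
theorem boundary_le_mass_add_energy (hp : 1 ≤ p) (hΩ : IsBoundedC2Domain Ω)
    (hβ : IsAngle Ω β) (hV : IsOrientedVarifold V) (hVΩ : weight V (closure Ω)ᶜ = 0)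
    (hΓ : IsCapillaryMeasure Ω β Γ) (hW : HasCurvatureAlong Ω V Γ W)
    (hE : curvatureEnergy p V W ≠ ⊤) {s : ℝ} (hs : ∀ x ∈ frontier Ω, s ≤ Real.sin (β x))
    {X : Amb n → Amb n} (hX : ContDiff ℝ 1 X) (hXν : ∀ x ∈ frontier Ω, X x = innerNormal Ω x)
    {L : ℝ} (hXb : ∀ y ∈ closure Ω, ‖X y‖ ≤ 1 ∧ ‖fderiv ℝ X y‖ ≤ L) :
    s * Γ.real univ ≤ 2 * ((n : ℝ) + 1) ^ 2 *
      ((L + 1) * V.real univ + ∫ z, frobNorm W z ^ p ∂V) := by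
  have hcomp : IsCompact (closure Ω) :=
    Metric.isCompact_of_isClosed_isBounded isClosed_closure hΩ.isBounded.closure
  have := isFiniteMeasure_of_isOrientedVarifold hV hcomp hVΩ
  have := isFiniteMeasure_of_isCapillaryMeasure hΩ hΓ
  obtain ⟨hi, hi', hid⟩ := hW.identity_vectorField hΩ hV hVΩ hΓ hX
  have hF := integrable_frobNorm_rpow hW.aemeasurable hE
  set N : ℝ := 2 * ((n : ℝ) + 1) ^ 2 with hN
  have hN0 : 0 < N := by positivity
  have h1 : s * Γ.real univ ≤ ∫ z, inner ℝ (X z.1) (conormal Ω z) ∂Γ := by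
    have h : ∫ _, s ∂Γ ≤ ∫ z, inner ℝ (X z.1) (conormal Ω z) ∂Γ := by
      refine integral_mono_ae (integrable_const s) hi' ?_
      filter_upwards [ae_mem_capBundle hΓ] with z hz
      rw [hXν _ hz.1, inner_innerNormal_conormal hΩ hβ hz]
      exact hs _ hz.1
    rwa [integral_const, smul_eq_mul, mul_comm] at h
  have h2 : (∫ z, N * (-(L + 1) - frobNorm W z ^ p) ∂V)
      ≤ ∫ z, (tangentialDiv X z - curvatureTerm W X z) ∂V := by
    refine integral_mono_ae (((integrable_const _).sub hF).const_mul N) hi ?_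
    filter_upwards [ae_fst_mem_and_norm_snd hV isClosed_closure hVΩ] with z hz
    have h3 := abs_tangentialDiv_le hz.2 (hXb _ hz.1).2
    have h4 := abs_curvatureTerm_le (W := W) hz.2 (hXb _ hz.1).1
    have h5 := le_add_rpow_mul_rpow (frobNorm_nonneg W z) one_pos hp
    rw [Real.one_rpow, one_mul] at h5
    rw [one_mul] at h4
    have h6 := mul_le_mul_of_nonneg_left h5 hN0.le
    have h7 := neg_le_of_abs_le h3
    have h8 := le_of_abs_le h4
    linarith
  have h3 : (∫ z, N * (-(L + 1) - frobNorm W z ^ p) ∂V)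
      = -(N * ((L + 1) * V.real univ + ∫ z, frobNorm W z ^ p ∂V)) := by
    rw [integral_const_mul, integral_sub (integrable_const _) hF, integral_const, smul_eq_mul]
    ring
  rw [h3, hid] at h2
  linarith

theorem minSin_le {x : Amb n} (hx : x ∈ frontier Ω) :
    minSin Ω β ≤ Real.sin (β x) := by
  refine ciInf_le (f := fun x : frontier Ω => Real.sin (β x)) ⟨-1, ?_⟩ ⟨x, hx⟩
  rintro _ ⟨y, rfl⟩
  exact Real.neg_one_le_sin _

theorem minSin_pos (hΩ : IsBoundedC2Domain Ω) (hβ : IsAngle Ω β) : 0 < minSin Ω β := by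
  obtain ⟨x, hx, hmin⟩ := (isCompact_frontier hΩ).exists_isMinOn (frontier_nonempty hΩ)
    (Real.continuous_sin.comp_continuousOn hβ.contDiffOn.continuousOn)
  have : Nonempty (frontier Ω) := ⟨⟨x, hx⟩⟩
  exact (Real.sin_pos_of_mem_Ioo (hβ.mem_Ioo x hx)).trans_le (le_ciInf fun y => hmin y.2)

theorem weight_eq_ofReal_univ {μ : Measure (Amb n × Amb n)} [IsFiniteMeasure μ]
    {K : Set (Amb n)} (hK : MeasurableSet K) (h : ∀ᵐ z ∂μ, z.1 ∈ K) :
    weight μ K = ENNReal.ofReal (μ.real univ) := by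
  rw [weight, Measure.map_apply measurable_fst hK, ofReal_measureReal]
  exact measure_eq_measure_of_null_sdiff (subset_univ _) (by
    rw [← compl_eq_univ_sdiff]; exact h)

end Estimates

end CapillaryVarifold

/-! ### Choice of the constant and conclusion -/

theorem lemma4 (n : ℕ) (hn : 1 ≤ n) (p : ℝ) (hp : 1 ≤ p) :
    ∃ C : ℝ → ℝ → ℝ → ℝ → ℝ, (∀ s D K ρ, 0 < C s D K ρ) ∧
      ∀ (Ω : Set (Amb n)) (β : Amb n → ℝ) (V Γ : Measure (Amb n × Amb n))
        (W : Fin (n + 1) → Fin (n + 1) → Amb n × Amb n → ℝ),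
        IsBoundedC2Domain Ω → IsAngle Ω β →
        IsOrientedIntegralVarifold V → weight V (closure Ω)ᶜ = 0 →
        IsRectifiableMeasure 2 (weight V) →
        IsCapillaryMeasure Ω β Γ → (∀ᵐ x ∂(weight V), x ∉ (weight Γ).support) →
        HasCurvatureAlong Ω V Γ W → (∀ i a, MemLp (W i a) (ENNReal.ofReal p) V) →
        weight V (closure Ω) ≤
            ENNReal.ofReal (C (minSin Ω β) (Metric.diam Ω) (secondFFSup Ω) (collarWidth Ω)) *
              (weight Γ (frontier Ω) + curvatureEnergy p V W) ∧
          weight Γ (frontier Ω) ≤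
            ENNReal.ofReal (C (minSin Ω β) (Metric.diam Ω) (secondFFSup Ω) (collarWidth Ω)) *
              (weight V (closure Ω) + curvatureEnergy p V W) := by
  set N : ℝ := 2 * ((n : ℝ) + 1) ^ 2 with hN
  have hN0 : 0 < N := by positivity
  -- `ε` makes `N D ε ≤ 1/2`; `δ` lies strictly below `ρ` and satisfies `δ K ≤ 1/2`. `A` and `B` are
  -- the resulting constants of the two estimates, and the maximum with 1 keeps `C` positive for all
  -- real arguments.
  let ε : ℝ → ℝ := fun D => 1 / (2 * N * (D + 1))
  let δ : ℝ → ℝ → ℝ := fun K ρ => min ρ (1 / (K + 1)) / 2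
  let A : ℝ → ℝ := fun D => 2 * D + 2 * N * D * ε D ^ (1 - p)
  let B : ℝ → ℝ → ℝ → ℝ := fun s K ρ => N * (2 / δ K ρ + 2 * K + 1) / s
  refine ⟨fun s D K ρ => max 1 (max (A D) (B s K ρ)),
    fun s D K ρ => zero_lt_one.trans_le (le_max_left _ _), ?_⟩
  intro Ω β V Γ W hΩ hβ hV hVΩ _ hΓ _ hW _
  have hV' := hV.toIsOrientedVarifold
  have hcomp : IsCompact (closure Ω) :=
    Metric.isCompact_of_isClosed_isBounded isClosed_closure hΩ.isBounded.closure
  have := isFiniteMeasure_of_isOrientedVarifold hV' hcomp hVΩ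
  have := isFiniteMeasure_of_isCapillaryMeasure hΩ hΓ
  set s := minSin Ω β with hs
  set D := Metric.diam Ω with hD
  set K := secondFFSup Ω with hK
  set ρ := collarWidth Ω with hρ
  have hs0 : 0 < s := minSin_pos hΩ hβ
  have hD0 : 0 ≤ D := Metric.diam_nonneg
  have hK0 : 0 ≤ K := secondFFSup_nonneg
  have hρ0 : 0 < ρ := collarWidth_pos hΩ
  set c : ℝ := max 1 (max (A D) (B s K ρ)) with hc
  have hc0 : 0 < c := zero_lt_one.trans_le (le_max_left _ _)
  have hcA : A D ≤ c := (le_max_left _ _).trans (le_max_right _ _)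
  have hcB : B s K ρ ≤ c := (le_max_right _ _).trans (le_max_right _ _)
  change _ ≤ ENNReal.ofReal c * _ ∧ _ ≤ ENNReal.ofReal c * _
  -- With infinite energy both right-hand sides are `⊤`, as `c > 0`. Otherwise all quantities are
  -- finite and the estimates reduce to real numbers.
  by_cases hE : curvatureEnergy p V W = ⊤
  · have h : ENNReal.ofReal c ≠ 0 := by simpa using hc0
    simp [hE, ENNReal.mul_top h]
  rw [weight_eq_ofReal_univ (μ := V) isClosed_closure.measurableSet
      ((ae_fst_mem_and_norm_snd hV' isClosed_closure hVΩ).mono fun z hz => hz.1),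
    weight_eq_ofReal_univ (μ := Γ) isClosed_frontier.measurableSet
      ((ae_mem_capBundle hΓ).mono fun z hz => hz.1),
    ← integral_frobNorm_rpow hW.aemeasurable hE]
  have hM : 0 ≤ V.real univ := measureReal_nonneg
  have hG : 0 ≤ Γ.real univ := measureReal_nonneg
  have hI : 0 ≤ ∫ z, frobNorm W z ^ p ∂V :=
    integral_nonneg fun z => Real.rpow_nonneg (frobNorm_nonneg W z) p
  rw [← ENNReal.ofReal_add hG hI, ← ENNReal.ofReal_add hM hI, ← ENNReal.ofReal_mul hc0.le,
    ← ENNReal.ofReal_mul hc0.le]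
  constructor
  · refine ENNReal.ofReal_le_ofReal ?_
    have hε : 0 < ε D := by positivity
    have hεD : N * (D * ε D) ≤ 1 / 2 := by
      have e : N * (D * ε D) = (D / (D + 1)) * (1 / 2) := by
        simp only [ε]; field_simp
      have h1 : D / (D + 1) ≤ 1 := (div_le_one (by positivity)).2 (by linarith)
      rw [e]; linarith
    have h := mass_le_boundary_add_energy hn hp hΩ hV' hVΩ hΓ hW hE hε hεD
    have hP : 0 ≤ ε D ^ (1 - p) := Real.rpow_nonneg hε.le _
    have hND : 0 ≤ 2 * N * D * ε D ^ (1 - p) := by positivity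
    have h1 : 2 * D ≤ c := le_trans (by simp only [A]; linarith) hcA
    have h2 : 2 * N * D * ε D ^ (1 - p) ≤ c := le_trans (by simp only [A]; linarith) hcA
    have h3 := mul_le_mul_of_nonneg_right h1 hG
    have h4 := mul_le_mul_of_nonneg_right h2 hI
    have h5 : 4 * ((n : ℝ) + 1) ^ 2 = 2 * N := by rw [hN]; ring
    rw [h5] at h
    linarith
  · refine ENNReal.ofReal_le_ofReal ?_
    have hδ : 0 < δ K ρ := by positivity
    have hδρ : δ K ρ < ρ := by
      have : min ρ (1 / (K + 1)) ≤ ρ := min_le_left _ _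
      simp only [δ]; linarith
    have hδK : δ K ρ * K ≤ 1 / 2 := by
      have h1 : min ρ (1 / (K + 1)) ≤ 1 / (K + 1) := min_le_right _ _
      have h2 : 1 / (K + 1) * K ≤ 1 := by
        rw [one_div_mul_eq_div, div_le_one (by positivity)]; linarith
      have h3 := mul_le_mul_of_nonneg_right h1 hK0
      simp only [δ]; linarith
    obtain ⟨X, hX, hXν, hXb⟩ := exists_normal_extension hΩ hδ hδρ hδK
    have h := boundary_le_mass_add_energy hp hΩ hβ hV' hVΩ hΓ hW hE
      (fun x hx => minSin_le hx) hX hXν hXb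
    set L := 2 / δ K ρ + 2 * K with hL
    have hL0 : 0 ≤ L := by positivity
    have h1 : s * Γ.real univ ≤ (N * (L + 1)) * (V.real univ + ∫ z, frobNorm W z ^ p ∂V) := by
      refine h.trans ?_
      rw [← hN, mul_assoc N]
      refine mul_le_mul_of_nonneg_left ?_ hN0.le
      nlinarith [mul_nonneg hL0 hI]
    calc Γ.real univ ≤ (N * (L + 1)) * (V.real univ + ∫ z, frobNorm W z ^ p ∂V) / s :=
          (le_div_iff₀' hs0).2 h1
      _ = B s K ρ * (V.real univ + ∫ z, frobNorm W z ^ p ∂V) := by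
          simp only [B, ← hL]; ring
      _ ≤ c * (V.real univ + ∫ z, frobNorm W z ^ p ∂V) :=
          mul_le_mul_of_nonneg_right hcB (by positivity)
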